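/- Throughout, $C^*$-algebras are unital. A (unital) Hilbert bimodule over a unital $C^*$-algebra $A$ is a complex Hilbert space $H$ with two commuting unital $*$-representations, one of $A$ (written $\xi\mapsto a\cdot\xi$) and one of the opposite algebra $A^{\mathrm{op}}$ (written $\xi\mapsto\xi\cdot a$). Put $H^A=\{\xi\in H: a\cdot\xi=\xi\cdot a \text{ for all } a\in A\}$, let $P_H^A$ be the orthogonal projection of $H$ onto $H^A$, and, for a non-empty finite set $Q\subseteq A$ and $\beta>0$, let $$V_H(Q,\beta)=\{\xi\in H:\ \|\xi\|=1,\ \|x\cdot\xi-\xi\cdot x\|<\beta\ \text{ for all } x\in Q\}.$$ An almost central unit vector for $A$ in $H$ is a net $(\xi_i)_{i\in I}$ of unit vectors of $H$ such that $\|a\cdot\xi_i-\xi_i\cdot a\|\to 0$ for every $a\in A$. $A$ has property $(T)$ if there are a non-empty finite set $F\subseteq A$ and $\epsilon>0$ such that $H^A\neq\{0\}$ for every Hilbert bimodule $H$ over $A$ with $V_H(F,\epsilon)\neq\emptyset$. $A$ has strong property $(T)$ if for every $\alpha>0$ there are a non-empty finite set $Q\subseteq A$ and $\beta>0$ such that $\|\xi-P_H^A(\xi)\|<\alpha$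 for every Hilbert bimodule $H$ over $A$ and every $\xi\in V_H(Q,\beta)$. **Theorem.** Let $B$ and $D$ be two unital $C^*$-algebras, let $A=B\otimes_{\max}D$ be their maximal and $A_0=B\otimes_{\min}D$ their minimal (spatial) $C^*$-tensor product. (a) If $B$ has strong property $(T)$ and $D$ has property $(T)$ (respectively, strong property $(T)$), then $A$ has property $(T)$ (respectively, strong property $(T)$). (b) If there is no almost central unit vector for $D$ in any Hilbert bimodule over $D$, then $A$ has strong property $(T)$. (c) Suppose that there is an almost central unit vector for $D$ in some Hilbert bimodule over $D$. If $A_0$ has property $(T)$ (respectively, strong property $(T)$), then so does $B$. (d) If $A_0$ has property $(T)$ (respectively, strong property $(T)$), then at least one of $B$ and $D$ has property $(T)$ (respectively, strong property $(T)$). -/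

import Mathlib

open scoped TensorProduct InnerProductSpace

universe u

noncomputable section

/-! ### C⋆-seminorms and the enveloping C⋆-algebra -/

/-- A C⋆-seminorm on a unital complex ⋆-algebra. -/
structure CStarSeminorm (X : Type u) [Ring X] [StarRing X] [Algebra ℂ X] extends Seminorm ℂ X where
  mul_le' : ∀ x y, toFun (x * y) ≤ toFun x * toFun y
  mul_self_le' : ∀ x, toFun x * toFun x ≤ toFun (star x * x)

namespace CStarSeminorm

variable {X : Type u} [Ring X] [StarRing X] [Algebra ℂ X]

/-- The ⋆-algebra `X`, regarded as seminormed by `p`. -/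
def Carrier (_p : CStarSeminorm X) : Type u := X

variable (p : CStarSeminorm X)

instance : Ring p.Carrier := inferInstanceAs (Ring X)
instance : StarRing p.Carrier := inferInstanceAs (StarRing X)
instance : Algebra ℂ p.Carrier := inferInstanceAs (Algebra ℂ X)
instance [StarModule ℂ X] : StarModule ℂ p.Carrier := inferInstanceAs (StarModule ℂ X)

theorem star_le (x : X) : p.toSeminorm (star x) ≤ p.toSeminorm x := by
  have h1 : p.toSeminorm (star x) * p.toSeminorm (star x)
      ≤ p.toSeminorm x * p.toSeminorm (star x) := by
    refine (p.mul_self_le' (star x)).trans ?_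
    rw [star_star]
    exact p.mul_le' x (star x)
  rcases (apply_nonneg p.toSeminorm (star x)).eq_or_lt with h | h
  · rw [← h]; exact apply_nonneg p.toSeminorm x
  · exact le_of_mul_le_mul_right h1 h

instance : SeminormedRing p.Carrier where
  toRing := inferInstance
  toNorm := p.toSeminorm.toAddGroupSeminorm.toSeminormedAddCommGroup.toNorm
  toPseudoMetricSpace := p.toSeminorm.toAddGroupSeminorm.toSeminormedAddCommGroup.toPseudoMetricSpace
  dist_eq := p.toSeminorm.toAddGroupSeminorm.toSeminormedAddCommGroup.dist_eq
  norm_mul_le := p.mul_le'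

theorem norm_def (x : p.Carrier) : ‖x‖ = p.toSeminorm x := rfl

instance : NormedAlgebra ℂ p.Carrier where
  toAlgebra := inferInstance
  norm_smul_le c x := (map_smul_eq_mul p.toSeminorm c x).le

instance : NormedStarGroup p.Carrier where
  norm_star_le := p.star_le

/-- The C⋆-algebra obtained from `X` by separation and completion with respect to `p`. -/
def Completion : Type u := UniformSpace.Completion p.Carrier

open UniformSpace

instance : NormedRing p.Completion :=
  inferInstanceAs (NormedRing (UniformSpace.Completion p.Carrier))

instance : CompleteSpace p.Completion :=
  inferInstanceAs (CompleteSpace (UniformSpace.Completion p.Carrier))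

instance : Algebra ℂ p.Completion :=
  inferInstanceAs (Algebra ℂ (UniformSpace.Completion p.Carrier))

instance : NormedAlgebra ℂ p.Completion where
  toAlgebra := inferInstance
  norm_smul_le c x :=
    norm_smul_le (α := ℂ) (β := UniformSpace.Completion p.Carrier) c x

/-- The canonical map from `X` to its completion with respect to `p`. -/
def toCompletion (x : X) : p.Completion := UniformSpace.Completion.coe' (α := p.Carrier) x

/-- The involution of the completion is the continuous extension of the involution of `X`. -/
instance : Star p.Completion where
  star := UniformSpace.Completion.map (star : p.Carrier → p.Carrier)

theorem continuous_star_completion : Continuous (star : p.Completion → p.Completion) :=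
  UniformSpace.Completion.continuous_map

theorem uniformContinuous_star_carrier :
    UniformContinuous (star : p.Carrier → p.Carrier) :=
  (starNormedAddGroupHom : NormedAddGroupHom p.Carrier p.Carrier).uniformContinuous

theorem star_toCompletion (x : X) : star (p.toCompletion x) = p.toCompletion (star x) :=
  UniformSpace.Completion.map_coe p.uniformContinuous_star_carrier x

theorem toCompletion_mul (x y : X) :
    p.toCompletion (x * y) = p.toCompletion x * p.toCompletion y :=
  UniformSpace.Completion.coe_mul (α := p.Carrier) x y

theorem toCompletion_add (x y : X) :
    p.toCompletion (x + y) = p.toCompletion x + p.toCompletion y :=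
  UniformSpace.Completion.coe_add (α := p.Carrier) x y

theorem toCompletion_smul (c : ℂ) (x : X) :
    p.toCompletion (c • x) = c • p.toCompletion x :=
  UniformSpace.Completion.coe_smul (X := p.Carrier) c x

theorem norm_toCompletion (x : X) : ‖p.toCompletion x‖ = p.toSeminorm x :=
  UniformSpace.Completion.norm_coe (E := p.Carrier) x

theorem denseRange_toCompletion : DenseRange p.toCompletion :=
  UniformSpace.Completion.denseRange_coe (α := p.Carrier)

instance : StarRing p.Completion where
  star_involutive x :=
    p.denseRange_toCompletion.induction_on (p := fun x => star (star x) = x) x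
      (isClosed_eq (p.continuous_star_completion.comp p.continuous_star_completion) continuous_id)
      fun a => by rw [star_toCompletion, star_toCompletion, star_star]
  star_mul x y :=
    p.denseRange_toCompletion.induction_on₂ (p := fun x y => star (x * y) = star y * star x)
      (isClosed_eq (p.continuous_star_completion.comp continuous_mul)
        ((p.continuous_star_completion.comp continuous_snd).mul
          (p.continuous_star_completion.comp continuous_fst)))
      (fun a b => by
        rw [← toCompletion_mul, star_toCompletion, star_toCompletion, star_toCompletion,
          star_mul, toCompletion_mul]) x y
  star_add x y :=
    p.denseRange_toCompletion.induction_on₂ (p := fun x y => star (x + y) = star x + star y)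
      (isClosed_eq (p.continuous_star_completion.comp continuous_add)
        ((p.continuous_star_completion.comp continuous_fst).add
          (p.continuous_star_completion.comp continuous_snd)))
      (fun a b => by
        rw [← toCompletion_add, star_toCompletion, star_toCompletion, star_toCompletion,
          star_add, toCompletion_add]) x y

instance [StarModule ℂ X] : CStarAlgebra p.Completion where
  norm_mul_self_le x :=
    p.denseRange_toCompletion.induction_on (p := fun x => ‖x‖ * ‖x‖ ≤ ‖star x * x‖) x
      (isClosed_le (continuous_norm.mul continuous_norm)
        (continuous_norm.comp (p.continuous_star_completion.mul continuous_id)))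
      fun a => by
        rw [star_toCompletion, ← toCompletion_mul, norm_toCompletion, norm_toCompletion]
        exact p.mul_self_le' a
  star_smul c x :=
    p.denseRange_toCompletion.induction_on (p := fun x => star (c • x) = star c • star x) x
      (isClosed_eq (p.continuous_star_completion.comp (continuous_const_smul c))
        (p.continuous_star_completion.const_smul (star c)))
      fun a => by
        rw [← toCompletion_smul, star_toCompletion, star_toCompletion, star_smul,
          toCompletion_smul]

end CStarSeminorm

/-! ### Representations on Hilbert spaces -/

/-- A unital ⋆-representation of a unital complex ⋆-algebra on a complex Hilbert space. -/
structure StarRep (X : Type u) [Ring X] [StarRing X] [Algebra ℂ X] : Type (u + 1) where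
  space : Type u
  [normedAddCommGroup : NormedAddCommGroup space]
  [innerProductSpace : InnerProductSpace ℂ space]
  [completeSpace : CompleteSpace space]
  hom : X →⋆ₐ[ℂ] (space →L[ℂ] space)

attribute [instance] StarRep.normedAddCommGroup StarRep.innerProductSpace StarRep.completeSpace

/-- The C⋆-seminorm `x ↦ sup_i ‖π_i x‖` of a pointwise bounded family of representations. -/
def StarRep.supSeminorm {X : Type u} [Ring X] [StarRing X] [Algebra ℂ X] {ι : Type (u + 1)}
    (π : ι → StarRep X) (hπ : ∀ x, BddAbove (Set.range fun i => ‖(π i).hom x‖)) :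
    CStarSeminorm X where
  toFun x := ⨆ i, ‖(π i).hom x‖
  map_zero' := by simp
  add_le' x y := by
    refine Real.iSup_le (fun i => ?_) (add_nonneg (Real.iSup_nonneg fun i => norm_nonneg _)
      (Real.iSup_nonneg fun i => norm_nonneg _))
    rw [map_add]
    exact (norm_add_le _ _).trans (add_le_add (le_ciSup (hπ x) i) (le_ciSup (hπ y) i))
  neg' x := by simp
  smul' c x := by
    simp only [map_smul, norm_smul]
    rw [Real.mul_iSup_of_nonneg (norm_nonneg c)]
  mul_le' x y := by
    refine Real.iSup_le (fun i => ?_) (mul_nonneg (Real.iSup_nonneg fun i => norm_nonneg _)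
      (Real.iSup_nonneg fun i => norm_nonneg _))
    rw [map_mul]
    exact (norm_mul_le _ _).trans (mul_le_mul (le_ciSup (hπ x) i) (le_ciSup (hπ y) i)
      (norm_nonneg _) (Real.iSup_nonneg fun i => norm_nonneg _))
  mul_self_le' x := by
    have h0 : 0 ≤ ⨆ i, ‖(π i).hom (star x * x)‖ := Real.iSup_nonneg fun i => norm_nonneg _
    have h1 : (⨆ i, ‖(π i).hom x‖) ≤ √(⨆ i, ‖(π i).hom (star x * x)‖) := by
      refine Real.iSup_le (fun i => Real.le_sqrt_of_sq_le ?_) (Real.sqrt_nonneg _)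
      have h2 := le_ciSup (hπ (star x * x)) i
      simp only [map_mul, map_star] at h2 ⊢
      rwa [CStarRing.norm_star_mul_self, ← sq] at h2
    calc (⨆ i, ‖(π i).hom x‖) * (⨆ i, ‖(π i).hom x‖)
        ≤ √(⨆ i, ‖(π i).hom (star x * x)‖) * √(⨆ i, ‖(π i).hom (star x * x)‖) :=
          mul_self_le_mul_self (Real.iSup_nonneg fun i => norm_nonneg _) h1
      _ = ⨆ i, ‖(π i).hom (star x * x)‖ := Real.mul_self_sqrt h0

variable (B D : Type u) [CStarAlgebra B] [CStarAlgebra D]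

/-- `b ↦ b ⊗ 1`. -/
def StarRep.inl : B →⋆ₐ[ℂ] B ⊗[ℂ] D :=
  { (Algebra.TensorProduct.includeLeft : B →ₐ[ℂ] B ⊗[ℂ] D) with
    map_star' := fun b => by simp [TensorProduct.star_tmul] }

/-- `d ↦ 1 ⊗ d`. -/
def StarRep.inr : D →⋆ₐ[ℂ] B ⊗[ℂ] D :=
  { (Algebra.TensorProduct.includeRight : D →ₐ[ℂ] B ⊗[ℂ] D) with
    map_star' := fun d => by simp [TensorProduct.star_tmul] }

theorem StarRep.bddAbove_tensor {ι : Type (u + 1)} (π : ι → StarRep (B ⊗[ℂ] D))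
    (x : B ⊗[ℂ] D) : BddAbove (Set.range fun i => ‖(π i).hom x‖) := by
  induction x using TensorProduct.induction_on with
  | zero => exact ⟨0, by rintro _ ⟨i, rfl⟩; simp⟩
  | tmul b d =>
    refine ⟨‖b‖ * ‖d‖, ?_⟩
    rintro _ ⟨i, rfl⟩
    have hb : ‖(π i).hom (b ⊗ₜ[ℂ] 1)‖ ≤ ‖b‖ := by
      have h := NonUnitalStarAlgHom.norm_apply_le
        (((π i).hom.comp (StarRep.inl B D)) : B →⋆ₐ[ℂ] _) b
      exact h
    have hd : ‖(π i).hom (1 ⊗ₜ[ℂ] d)‖ ≤ ‖d‖ := by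
      have h := NonUnitalStarAlgHom.norm_apply_le
        (((π i).hom.comp (StarRep.inr B D)) : D →⋆ₐ[ℂ] _) d
      exact h
    have hbd : b ⊗ₜ[ℂ] d = (b ⊗ₜ[ℂ] (1 : D)) * ((1 : B) ⊗ₜ[ℂ] d) := by simp
    simp only [hbd, map_mul]
    exact (norm_mul_le _ _).trans (mul_le_mul hb hd (norm_nonneg _) (norm_nonneg _))
  | add x y hx hy =>
    obtain ⟨M, hM⟩ := hx
    obtain ⟨N, hN⟩ := hy
    refine ⟨M + N, ?_⟩
    rintro _ ⟨i, rfl⟩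
    simp only [map_add]
    exact (norm_add_le _ _).trans (add_le_add (hM ⟨i, rfl⟩) (hN ⟨i, rfl⟩))

section TensorRep

open UniformSpace

variable {E F : Type u} [NormedAddCommGroup E] [InnerProductSpace ℂ E]
  [NormedAddCommGroup F] [InnerProductSpace ℂ F]

theorem inner_rTensor (S : E →L[ℂ] E) [CompleteSpace E] (x y : E ⊗[ℂ] F) :
    ⟪(star S).rTensor F x, y⟫_ℂ = ⟪x, S.rTensor F y⟫_ℂ := by
  induction x using TensorProduct.induction_on with
  | zero => simp
  | add x x' hx hx' => simp only [map_add, inner_add_left, hx, hx']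
  | tmul e f =>
    induction y using TensorProduct.induction_on with
    | zero => simp
    | add y y' hy hy' => simp only [map_add, inner_add_right, hy, hy']
    | tmul e' f' =>
      simp [ContinuousLinearMap.star_eq_adjoint, ContinuousLinearMap.adjoint_inner_left]

theorem inner_lTensor (S : F →L[ℂ] F) [CompleteSpace F] (x y : E ⊗[ℂ] F) :
    ⟪(star S).lTensor E x, y⟫_ℂ = ⟪x, S.lTensor E y⟫_ℂ := by
  induction x using TensorProduct.induction_on with
  | zero => simp
  | add x x' hx hx' => simp only [map_add, inner_add_left, hx, hx']
  | tmul e f =>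
    induction y using TensorProduct.induction_on with
    | zero => simp
    | add y y' hy hy' => simp only [map_add, inner_add_right, hy, hy']
    | tmul e' f' =>
      simp [ContinuousLinearMap.star_eq_adjoint, ContinuousLinearMap.adjoint_inner_left]

/-- The Hilbert space tensor product: the completion of the algebraic tensor product. -/
def HilbertTensor (E F : Type u) [NormedAddCommGroup E] [InnerProductSpace ℂ E]
    [NormedAddCommGroup F] [InnerProductSpace ℂ F] : Type u :=
  Completion (E ⊗[ℂ] F)

instance : NormedAddCommGroup (HilbertTensor E F) :=
  inferInstanceAs (NormedAddCommGroup (Completion (E ⊗[ℂ] F)))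

instance : InnerProductSpace ℂ (HilbertTensor E F) :=
  inferInstanceAs (InnerProductSpace ℂ (Completion (E ⊗[ℂ] F)))

instance : CompleteSpace (HilbertTensor E F) :=
  inferInstanceAs (CompleteSpace (Completion (E ⊗[ℂ] F)))

/-- The canonical isometry from the algebraic tensor product. -/
def HilbertTensor.incl (E F : Type u) [NormedAddCommGroup E] [InnerProductSpace ℂ E]
    [NormedAddCommGroup F] [InnerProductSpace ℂ F] : E ⊗[ℂ] F →ₗᵢ[ℂ] HilbertTensor E F :=
  Completion.toComplₗᵢ (𝕜 := ℂ) (E := E ⊗[ℂ] F)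

theorem HilbertTensor.denseRange_incl : DenseRange (HilbertTensor.incl E F) :=
  Completion.denseRange_coe (α := E ⊗[ℂ] F)

/-- The continuous extension to the Hilbert space tensor product of a bounded operator on the
algebraic tensor product. -/
def HilbertTensor.extend (S : E ⊗[ℂ] F →L[ℂ] E ⊗[ℂ] F) :
    HilbertTensor E F →L[ℂ] HilbertTensor E F :=
  S.completion

theorem HilbertTensor.extend_incl (S : E ⊗[ℂ] F →L[ℂ] E ⊗[ℂ] F) (x : E ⊗[ℂ] F) :
    HilbertTensor.extend S (HilbertTensor.incl E F x) = HilbertTensor.incl E F (S x) :=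
  S.completion_apply_coe x

theorem HilbertTensor.ext {f g : HilbertTensor E F →L[ℂ] HilbertTensor E F}
    (h : ∀ x, f (HilbertTensor.incl E F x) = g (HilbertTensor.incl E F x)) : f = g :=
  ContinuousLinearMap.ext fun y =>
    HilbertTensor.denseRange_incl.induction_on (p := fun y => f y = g y) y
      (isClosed_eq f.continuous g.continuous) h

theorem HilbertTensor.star_extend {S T : E ⊗[ℂ] F →L[ℂ] E ⊗[ℂ] F}
    (h : ∀ x y, ⟪S x, y⟫_ℂ = ⟪x, T y⟫_ℂ) :
    star (HilbertTensor.extend T) = HilbertTensor.extend S := by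
  rw [ContinuousLinearMap.star_eq_adjoint, eq_comm, ContinuousLinearMap.eq_adjoint_iff]
  intro x y
  refine HilbertTensor.denseRange_incl.induction_on₂
    (p := fun x y => ⟪HilbertTensor.extend S x, y⟫_ℂ = ⟪x, HilbertTensor.extend T y⟫_ℂ)
    (isClosed_eq
      (Continuous.inner ((HilbertTensor.extend S).continuous.comp continuous_fst) continuous_snd)
      (Continuous.inner continuous_fst ((HilbertTensor.extend T).continuous.comp continuous_snd)))
    (fun x y => ?_) x y
  rw [HilbertTensor.extend_incl, HilbertTensor.extend_incl, LinearIsometry.inner_map_map,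
    LinearIsometry.inner_map_map, h]

/-- The amplification `S ↦ S ⊗ 1` on the Hilbert space tensor product. -/
def ampLeft (E F : Type u) [NormedAddCommGroup E] [InnerProductSpace ℂ E] [CompleteSpace E]
    [NormedAddCommGroup F] [InnerProductSpace ℂ F] :
    (E →L[ℂ] E) →⋆ₐ[ℂ] (HilbertTensor E F →L[ℂ] HilbertTensor E F) where
  toFun S := HilbertTensor.extend (S.rTensor F)
  map_one' := HilbertTensor.ext fun x => by simp [HilbertTensor.extend_incl]
  map_mul' S T := HilbertTensor.ext fun x => by
    simp [HilbertTensor.extend_incl, ContinuousLinearMap.rTensor_mul]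
  map_zero' := HilbertTensor.ext fun x => by simp [HilbertTensor.extend_incl]
  map_add' S T := HilbertTensor.ext fun x => by simp [HilbertTensor.extend_incl]
  commutes' c := HilbertTensor.ext fun x => by
    simp [HilbertTensor.extend_incl, Algebra.algebraMap_eq_smul_one]
  map_star' S := (HilbertTensor.star_extend fun x y => inner_rTensor S x y).symm

/-- The amplification `T ↦ 1 ⊗ T` on the Hilbert space tensor product. -/
def ampRight (E F : Type u) [NormedAddCommGroup E] [InnerProductSpace ℂ E]
    [NormedAddCommGroup F] [InnerProductSpace ℂ F] [CompleteSpace F] :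
    (F →L[ℂ] F) →⋆ₐ[ℂ] (HilbertTensor E F →L[ℂ] HilbertTensor E F) where
  toFun S := HilbertTensor.extend (S.lTensor E)
  map_one' := HilbertTensor.ext fun x => by simp [HilbertTensor.extend_incl]
  map_mul' S T := HilbertTensor.ext fun x => by
    simp [HilbertTensor.extend_incl, ContinuousLinearMap.lTensor_mul]
  map_zero' := HilbertTensor.ext fun x => by simp [HilbertTensor.extend_incl]
  map_add' S T := HilbertTensor.ext fun x => by simp [HilbertTensor.extend_incl]
  commutes' c := HilbertTensor.ext fun x => by
    simp [HilbertTensor.extend_incl, Algebra.algebraMap_eq_smul_one]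
  map_star' S := (HilbertTensor.star_extend fun x y => inner_lTensor S x y).symm

theorem ampLeft_incl [CompleteSpace E] (S : E →L[ℂ] E) (x : E ⊗[ℂ] F) :
    ampLeft E F S (HilbertTensor.incl E F x) = HilbertTensor.incl E F (S.rTensor F x) :=
  HilbertTensor.extend_incl _ x

theorem ampRight_incl [CompleteSpace F] (T : F →L[ℂ] F) (x : E ⊗[ℂ] F) :
    ampRight E F T (HilbertTensor.incl E F x) = HilbertTensor.incl E F (T.lTensor E x) :=
  HilbertTensor.extend_incl _ x

theorem commute_amp [CompleteSpace E] [CompleteSpace F] (S : E →L[ℂ] E) (T : F →L[ℂ] F) :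
    Commute (ampLeft E F S) (ampRight E F T) :=
  HilbertTensor.ext fun x => by
    rw [mul_apply_eq_comp, mul_apply_eq_comp, ampLeft_incl, ampRight_incl,
      ampLeft_incl, ampRight_incl]
    induction x using TensorProduct.induction_on with
    | zero => simp only [map_zero]
    | add x y hx hy => simp only [map_add, hx, hy]
    | tmul e f => simp only [ContinuousLinearMap.rTensor_tmul, ContinuousLinearMap.lTensor_tmul]

variable {B D}

theorem star_amp_mul_amp (π : StarRep B) (ρ : StarRep D) (b : B) (d : D) :
    ampLeft π.space ρ.space (π.hom (star b)) * ampRight π.space ρ.space (ρ.hom (star d)) =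
      star (ampLeft π.space ρ.space (π.hom b) * ampRight π.space ρ.space (ρ.hom d)) := by
  rw [(commute_amp _ _).eq, star_mul, map_star, map_star, map_star, map_star]

/-- The tensor product `π ⊗ ρ` of two representations, acting on the Hilbert space tensor product
(the completion of the algebraic one). -/
def StarRep.tensor (π : StarRep B) (ρ : StarRep D) : StarRep (B ⊗[ℂ] D) where
  space := HilbertTensor π.space ρ.space
  hom :=
    { Algebra.TensorProduct.lift
        ((ampLeft π.space ρ.space).comp π.hom).toAlgHom
        ((ampRight π.space ρ.space).comp ρ.hom).toAlgHom
        (fun _ _ => commute_amp _ _) with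
      map_star' := fun x => by
        induction x using TensorProduct.induction_on with
        | zero => simp
        | add x y hx hy => simp_all [star_add]
        | tmul b d => exact star_amp_mul_amp π ρ b d }

theorem StarRep.tensor_hom_tmul (π : StarRep B) (ρ : StarRep D) (b : B) (d : D)
    (ξ : π.space) (η : ρ.space) :
    (π.tensor ρ).hom (b ⊗ₜ[ℂ] d) (HilbertTensor.incl π.space ρ.space (ξ ⊗ₜ[ℂ] η)) =
      HilbertTensor.incl π.space ρ.space ((π.hom b ξ) ⊗ₜ[ℂ] (ρ.hom d η)) := by
  change (ampLeft π.space ρ.space (π.hom b) * ampRight π.space ρ.space (ρ.hom d)) _ = _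
  rw [mul_apply_eq_comp, ampRight_incl, ampLeft_incl,
    ContinuousLinearMap.lTensor_tmul, ContinuousLinearMap.rTensor_tmul]

end TensorRep

/-- The maximal C⋆-norm on the algebraic tensor product: `‖x‖_max = sup ‖π x‖` over all
⋆-representations `π` of `B ⊗ D`. -/
def maxCStarSeminorm : CStarSeminorm (B ⊗[ℂ] D) :=
  StarRep.supSeminorm (fun π : StarRep (B ⊗[ℂ] D) => π) (StarRep.bddAbove_tensor B D _)

/-- The minimal (spatial) C⋆-norm on the algebraic tensor product: `‖x‖_min = sup ‖(π ⊗ ρ) x‖` over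
all representations `π` of `B` and `ρ` of `D`. -/
def minCStarSeminorm : CStarSeminorm (B ⊗[ℂ] D) :=
  StarRep.supSeminorm (fun q : StarRep B × StarRep D => q.1.tensor q.2)
    (StarRep.bddAbove_tensor B D _)

/-- The maximal C⋆-tensor product. -/
abbrev MaxTensor : Type u := (maxCStarSeminorm B D).Completion

/-- The minimal (spatial) C⋆-tensor product. -/
abbrev MinTensor : Type u := (minCStarSeminorm B D).Completion

/-! ### Hilbert bimodules and property (T) -/

/-- A unital Hilbert bimodule over `A`: a Hilbert space with commuting unital ⋆-representations of
`A` (the left action) and of the opposite algebra of `A` (the right action). -/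
structure HilbertBimodule (A : Type u) [CStarAlgebra A] : Type (u + 1) where
  space : Type u
  [normedAddCommGroup : NormedAddCommGroup space]
  [innerProductSpace : InnerProductSpace ℂ space]
  [completeSpace : CompleteSpace space]
  left : A →⋆ₐ[ℂ] (space →L[ℂ] space)
  right : Aᵐᵒᵖ →⋆ₐ[ℂ] (space →L[ℂ] space)
  commute : ∀ (a : A) (b : Aᵐᵒᵖ), Commute (left a) (right b)

attribute [instance] HilbertBimodule.normedAddCommGroup HilbertBimodule.innerProductSpace
  HilbertBimodule.completeSpace

namespace HilbertBimodule

variable {A : Type u} [CStarAlgebra A] (H : HilbertBimodule A)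

/-- The closed subspace of central vectors, i.e. of all `ξ` with `a · ξ = ξ · a` for all `a`. -/
def central : Submodule ℂ H.space where
  carrier := {ξ | ∀ a : A, H.left a ξ = H.right (MulOpposite.op a) ξ}
  zero_mem' a := by simp
  add_mem' hx hy a := by simp [hx a, hy a]
  smul_mem' c x hx a := by simp [hx a]

theorem isClosed_central : IsClosed (H.central : Set H.space) := by
  have : (H.central : Set H.space) =
      ⋂ a : A, {ξ | H.left a ξ = H.right (MulOpposite.op a) ξ} := by
    ext ξ; simp [central]
  rw [this]
  exact isClosed_iInter fun a => isClosed_eq (H.left a).continuous (H.right _).continuous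

instance : CompleteSpace H.central := H.isClosed_central.completeSpace_coe

/-- The `(Q, β)`-central unit vectors. -/
def almostCentral (Q : Finset A) (β : ℝ) : Set H.space :=
  {ξ | ‖ξ‖ = 1 ∧ ∀ x ∈ Q, ‖H.left x ξ - H.right (MulOpposite.op x) ξ‖ < β}

/-- There is an almost central unit vector in `H`: a net of unit vectors `ξ i` with
`‖a · ξ i - ξ i · a‖ → 0` for every `a`. -/
def HasAlmostCentralUnitVector : Prop :=
  ∃ (I : Type u) (_ : Preorder I) (_ : IsDirectedOrder I) (_ : Nonempty I) (ξ : I → H.space),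
    (∀ i, ‖ξ i‖ = 1) ∧ ∀ a : A, Filter.Tendsto
      (fun i => ‖H.left a (ξ i) - H.right (MulOpposite.op a) (ξ i)‖) Filter.atTop (nhds 0)

end HilbertBimodule

/-- Property (T) of a unital C⋆-algebra. -/
def HasPropertyT (A : Type u) [CStarAlgebra A] : Prop :=
  ∃ F : Finset A, F.Nonempty ∧ ∃ ε : ℝ, 0 < ε ∧
    ∀ H : HilbertBimodule A, (H.almostCentral F ε).Nonempty → H.central ≠ ⊥

/-- Strong property (T) of a unital C⋆-algebra. -/
def HasStrongPropertyT (A : Type u) [CStarAlgebra A] : Prop :=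
  ∀ α : ℝ, 0 < α → ∃ Q : Finset A, Q.Nonempty ∧ ∃ β : ℝ, 0 < β ∧
    ∀ (H : HilbertBimodule A), ∀ ξ ∈ H.almostCentral Q β, ‖ξ - H.central.starProjection ξ‖ < α

end

/-! For (a), let `H` be a bimodule over a completion of `B ⊗ D` and `ξ` a unit vector almost central
for suitable elements of `B` and `D`. Strong (T) of `B` puts `ξ` close to the space of `B`-central
vectors. Since `D` commutes with `B`, this space reduces both actions of `D`, so it is a bimodule
over `D`, and the projection of `ξ`, once normalised, is almost central for `D` in it. Property (T)
of `D` then gives a non-zero vector central for both factors, or a nearby one in the strong case; by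
density it is central for the whole algebra. No particular C⋆-norm is needed
(`exists_almostCentral_centralBimodule`).

For (b), if every pair `(F, ε)` admitted an almost central unit vector in some bimodule, the direct
sum of these bimodules would carry a whole net of them. So without such nets some pair admits none
at all, and both forms of (T) hold vacuously. Restriction along `D → A` carries the absence of nets
from `D` to `A`.

For (c), if `ξ` and `η` are almost central in `H` and `K`, then `ξ ⊗ η` is almost central in `H ⊗
K`. That `H ⊗ K` is a bimodule over the minimal tensor product is clear for the left action; for the
right action, antiunitary operators turn representations of the opposite algebras into
representations of the algebras (`norm_tensorRightHom_le`). Back in `H`, the adjoint of `ξ ↦ ξ ⊗ η`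
sends central vectors to central vectors and, for a unit vector `η`, is a contraction taking `ξ ⊗ η`
to `ξ`.

Part (d) is a dichotomy: either (c) applies, or `D` has (T) vacuously. -/

noncomputable section

open MulOpposite

/-! ### Opposite homomorphisms, invariant subspaces and direct sums -/

section Hom

variable {A C : Type*} [Ring A] [StarRing A] [Algebra ℂ A] [Ring C] [StarRing C] [Algebra ℂ C]

/-- The homomorphism of opposite algebras induced by a ⋆-homomorphism. -/
def StarAlgHom.mulOpposite (f : A →⋆ₐ[ℂ] C) : Aᵐᵒᵖ →⋆ₐ[ℂ] Cᵐᵒᵖ where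
  __ := AlgHom.op f.toAlgHom
  map_star' a := congrArg op (map_star f a.unop)

/-- A ⋆-homomorphism into an opposite algebra, viewed on the opposite algebra. -/
def StarAlgHom.fromOpposite (f : A →⋆ₐ[ℂ] Cᵐᵒᵖ) : Aᵐᵒᵖ →⋆ₐ[ℂ] C where
  toFun a := (f a.unop).unop
  map_one' := by simp
  map_mul' a b := by simp
  map_zero' := by simp
  map_add' a b := by simp
  commutes' c := by
    change (f (algebraMap ℂ A c)).unop = _
    rw [AlgHomClass.commutes]; rfl
  map_star' a := by
    change (f (star a.unop)).unop = _
    rw [map_star]; rfl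

/-- A ⋆-homomorphism on an opposite algebra, viewed as mapping to the opposite algebra. -/
def StarAlgHom.toOpposite (f : Aᵐᵒᵖ →⋆ₐ[ℂ] C) : A →⋆ₐ[ℂ] Cᵐᵒᵖ where
  toFun a := op (f (op a))
  map_one' := by simp
  map_mul' a b := by simp
  map_zero' := by simp
  map_add' a b := by simp
  commutes' c := by
    change op (f (algebraMap ℂ Aᵐᵒᵖ c)) = _
    rw [AlgHomClass.commutes]; rfl
  map_star' a := by
    change op (f (star (op a))) = _
    rw [map_star]; rfl

end Hom

section Restrict

variable {A E : Type*} [Ring A] [StarRing A] [Algebra ℂ A] [NormedAddCommGroup E]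
  [InnerProductSpace ℂ E] [CompleteSpace E]

theorem StarAlgHom.inner_apply_star_left (φ : A →⋆ₐ[ℂ] (E →L[ℂ] E)) (a : A) (x y : E) :
    ⟪φ (star a) x, y⟫_ℂ = ⟪x, φ a y⟫_ℂ := by
  rw [map_star, ContinuousLinearMap.star_eq_adjoint, ContinuousLinearMap.adjoint_inner_left]

theorem StarAlgHom.inner_apply_left (φ : A →⋆ₐ[ℂ] (E →L[ℂ] E)) (a : A) (x y : E) :
    ⟪φ a x, y⟫_ℂ = ⟪x, φ (star a) y⟫_ℂ := by
  rw [← StarAlgHom.inner_apply_star_left, star_star]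

/-- The restriction of a ⋆-representation to an invariant closed subspace. -/
def StarAlgHom.restrictInvariant (φ : A →⋆ₐ[ℂ] (E →L[ℂ] E)) (U : Submodule ℂ E) [CompleteSpace U]
    (h : ∀ a, ∀ u ∈ U, φ a u ∈ U) : A →⋆ₐ[ℂ] (U →L[ℂ] U) where
  toFun a := ((φ a).comp U.subtypeL).codRestrict U fun u => h a u u.2
  map_one' := by ext; simp
  map_mul' a b := by ext u; exact DFunLike.congr_fun (map_mul φ a b) (u : E)
  map_zero' := by ext; simp
  map_add' a b := by ext u; exact DFunLike.congr_fun (map_add φ a b) (u : E)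
  commutes' c := by ext; simp [Algebra.algebraMap_eq_smul_one]
  map_star' a := by
    rw [ContinuousLinearMap.star_eq_adjoint, ContinuousLinearMap.eq_adjoint_iff]
    exact fun x y => φ.inner_apply_star_left a (x : E) y

/-- Invariance under `φ (star a)` makes the orthogonal complement invariant under `φ a`, so `U` is
reducing. -/
theorem StarAlgHom.starProjection_apply_of_invariant (φ : A →⋆ₐ[ℂ] (E →L[ℂ] E))
    (U : Submodule ℂ E) [CompleteSpace U] (h : ∀ a, ∀ u ∈ U, φ a u ∈ U) (a : A) (x : E) :
    U.starProjection (φ a x) = φ a (U.starProjection x) := by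
  refine Submodule.eq_starProjection_of_mem_of_inner_eq_zero (h a _ (Submodule.starProjection_apply_mem _ _))
    fun w hw => ?_
  rw [← map_sub, StarAlgHom.inner_apply_left]
  exact Submodule.starProjection_inner_eq_zero _ _ (h _ _ hw)

end Restrict

theorem Submodule.norm_sub_starProjection_le {E : Type*} [NormedAddCommGroup E]
    [InnerProductSpace ℂ E] (U : Submodule ℂ E) [U.HasOrthogonalProjection] (x : E) {u : E}
    (hu : u ∈ U) : ‖x - U.starProjection x‖ ≤ ‖x - u‖ := by
  rw [Submodule.starProjection_minimal]
  exact ciInf_le ⟨0, by rintro _ ⟨y, rfl⟩; exact norm_nonneg _⟩ (⟨u, hu⟩ : U)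

section DirectSum

variable {A : Type*} [CStarAlgebra A] {ι : Type*} {E : ι → Type*} [∀ i, NormedAddCommGroup (E i)]
  [∀ i, InnerProductSpace ℂ (E i)] [∀ i, CompleteSpace (E i)]

/-- The Hilbert space direct sum of a family of ⋆-representations. -/
def StarAlgHom.hilbertSum (φ : ∀ i, A →⋆ₐ[ℂ] (E i →L[ℂ] E i)) :
    A →⋆ₐ[ℂ] (lp E 2 →L[ℂ] lp E 2) where
  toFun a := lp.mapCLM 2 (fun i => φ i a) (norm_nonneg a)
    fun i => NonUnitalStarAlgHom.norm_apply_le (φ i) a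
  map_one' := by ext; simp
  map_mul' a b := by ext; simp
  map_zero' := by ext; simp
  map_add' a b := by ext; simp
  commutes' c := by ext; simp [Algebra.algebraMap_eq_smul_one]
  map_star' a := by
    rw [ContinuousLinearMap.star_eq_adjoint, ContinuousLinearMap.eq_adjoint_iff]
    intro x y
    simp [lp.inner_eq_tsum, StarAlgHom.inner_apply_star_left]

@[simp]
theorem StarAlgHom.hilbertSum_apply (φ : ∀ i, A →⋆ₐ[ℂ] (E i →L[ℂ] E i)) (a : A) (x : lp E 2)
    (i : ι) : StarAlgHom.hilbertSum φ a x i = φ i a (x i) := rfl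

theorem StarAlgHom.hilbertSum_single [DecidableEq ι] (φ : ∀ i, A →⋆ₐ[ℂ] (E i →L[ℂ] E i)) (a : A)
    (i : ι) (x : E i) :
    StarAlgHom.hilbertSum φ a (lp.single 2 i x) = lp.single 2 i (φ i a x) := by
  refine lp.ext (funext fun j => ?_)
  rw [StarAlgHom.hilbertSum_apply]
  rcases eq_or_ne j i with rfl | hji
  · rw [lp.single_apply_self, lp.single_apply_self]
  · rw [lp.single_apply_ne _ _ _ hji, lp.single_apply_ne _ _ _ hji, map_zero]

end DirectSum

/-! ### Pullbacks, direct sums and nets of almost central vectors -/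

namespace HilbertBimodule

variable {A : Type u} [CStarAlgebra A]

/-- The pullback of a Hilbert bimodule along a unital ⋆-homomorphism. -/
def comap {B : Type u} [CStarAlgebra B] (f : B →⋆ₐ[ℂ] A) (H : HilbertBimodule A) :
    HilbertBimodule B where
  space := H.space
  left := H.left.comp f
  right := H.right.comp f.mulOpposite
  commute _ _ := H.commute _ _

/-- The direct sum of a family of Hilbert bimodules. -/
def directSum {ι : Type u} (H : ι → HilbertBimodule A) : HilbertBimodule A where
  space := lp (fun i => (H i).space) 2
  left := StarAlgHom.hilbertSum fun i => (H i).left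
  right := StarAlgHom.hilbertSum fun i => (H i).right
  commute a b := by
    ext x i
    exact DFunLike.congr_fun ((H i).commute a b).eq (x i)

/-- Only norms of vectors and of their commutators enter almost centrality, so a bare function
preserving both is enough. -/
theorem exists_isometry_directSum {ι : Type u} (H : ι → HilbertBimodule A) (i : ι) :
    ∃ S : (H i).space → (directSum H).space, (∀ x, ‖S x‖ = ‖x‖) ∧
      ∀ a x, ‖(directSum H).left a (S x) - (directSum H).right (op a) (S x)‖ =
        ‖(H i).left a x - (H i).right (op a) x‖ := by
  classical
  have h2 : ∀ y : (H i).space, ‖lp.single (E := fun i => (H i).space) 2 i y‖ = ‖y‖ :=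
    lp.norm_single (E := fun i => (H i).space) (p := 2) (by norm_num) i
  refine ⟨fun x => lp.single (E := fun i => (H i).space) 2 i x, h2, fun a x => ?_⟩
  have hl := StarAlgHom.hilbertSum_single (fun i => (H i).left) a i x
  have hr := StarAlgHom.hilbertSum_single (fun i => (H i).right) (op a) i x
  rw [← h2, lp.single_sub, ← hl, ← hr]
  rfl

/-- The net is indexed by pairs `(F, n)`, with tolerance `1 / (n + 1)`. The vectors live in
different bimodules, and the direct sum of all these holds them together. -/
theorem exists_hasAlmostCentralUnitVector
    (h : ∀ (F : Finset A) (ε : ℝ), 0 < ε →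
      ∃ H : HilbertBimodule A, (H.almostCentral F ε).Nonempty) :
    ∃ K : HilbertBimodule A, K.HasAlmostCentralUnitVector := by
  have hpos : ∀ n : ℕ, (0 : ℝ) < 1 / (n + 1) := fun n => Nat.one_div_pos_of_nat
  choose H hH using fun i : Finset A × ℕ => h i.1 _ (hpos i.2)
  choose η hη using hH
  choose S hS hS' using exists_isometry_directSum H
  refine ⟨directSum H, Finset A × ℕ, inferInstance, by classical infer_instance, inferInstance,
    fun i => S i (η i), fun i => (hS i _).trans (hη i).1, fun a => ?_⟩
  rw [Metric.tendsto_nhds]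
  intro ε hε
  obtain ⟨n, hn⟩ := exists_nat_one_div_lt hε
  refine Filter.mem_of_superset (Filter.Ici_mem_atTop ({a}, n)) fun i hi => ?_
  rw [Set.mem_ofPred_eq, dist_zero_right, norm_norm, hS']
  refine ((hη i).2 a (hi.1 (Finset.mem_singleton_self a))).trans (lt_of_le_of_lt ?_ hn)
  have : (n : ℝ) ≤ i.2 := Nat.cast_le.2 hi.2
  gcongr

theorem HasAlmostCentralUnitVector.almostCentral_nonempty {K : HilbertBimodule A}
    (hK : K.HasAlmostCentralUnitVector) (F : Finset A) {ε : ℝ} (hε : 0 < ε) :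
    (K.almostCentral F ε).Nonempty := by
  obtain ⟨I, _, _, _, ξ, h1, h2⟩ := hK
  have : ∀ᶠ i in Filter.atTop, ∀ x ∈ F, ‖K.left x (ξ i) - K.right (op x) (ξ i)‖ < ε :=
    (Filter.eventually_all_finset F).2 fun x _ => (h2 x).eventually_lt_const hε
  obtain ⟨i, hi⟩ := this.exists
  exact ⟨ξ i, h1 i, hi⟩

theorem almostCentral_subset (H : HilbertBimodule A) {F G : Finset A} (hFG : F ⊆ G) {δ ε : ℝ}
    (h : δ ≤ ε) : H.almostCentral G δ ⊆ H.almostCentral F ε :=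
  fun _ hξ => ⟨hξ.1, fun x hx => (hξ.2 x (hFG hx)).trans_le h⟩

theorem exists_almostCentral_eq_empty (h : ∀ K : HilbertBimodule A, ¬ K.HasAlmostCentralUnitVector) :
    ∃ F : Finset A, F.Nonempty ∧ ∃ ε : ℝ, 0 < ε ∧
      ∀ H : HilbertBimodule A, H.almostCentral F ε = ∅ := by
  classical
  by_contra! hc
  obtain ⟨K, hK⟩ := exists_hasAlmostCentralUnitVector (A := A) fun F ε hε => by
    -- Inserting `1` only serves to make the finite set non-empty.
    obtain ⟨H, hH⟩ := hc (insert 1 F) (Finset.insert_nonempty _ _) ε hε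
    exact ⟨H, hH.mono (H.almostCentral_subset (Finset.subset_insert _ _) le_rfl)⟩
  exact h K hK

end HilbertBimodule

theorem hasStrongPropertyT_of_forall_not {A : Type u} [CStarAlgebra A]
    (h : ∀ K : HilbertBimodule A, ¬ K.HasAlmostCentralUnitVector) : HasStrongPropertyT A := by
  obtain ⟨F, hF, ε, hε, hH⟩ := HilbertBimodule.exists_almostCentral_eq_empty h
  exact fun _ _ => ⟨F, hF, ε, hε, fun H ξ hξ => by simp [hH H] at hξ⟩

theorem hasPropertyT_of_forall_not {A : Type u} [CStarAlgebra A]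
    (h : ∀ K : HilbertBimodule A, ¬ K.HasAlmostCentralUnitVector) : HasPropertyT A := by
  obtain ⟨F, hF, ε, hε, hH⟩ := HilbertBimodule.exists_almostCentral_eq_empty h
  exact ⟨F, hF, ε, hε, fun H hξ => by simp [hH H] at hξ⟩

/-! ### Commuting subalgebras and the maximal tensor product -/

namespace CStarSeminorm

section

variable {X : Type u} [Ring X] [StarRing X] [Algebra ℂ X] [StarModule ℂ X] (p : CStarSeminorm X)

/-- The canonical map to the completion, as a ⋆-homomorphism. -/
def toCompletionHom : X →⋆ₐ[ℂ] p.Completion where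
  toFun := p.toCompletion
  map_one' := rfl
  map_mul' := p.toCompletion_mul
  map_zero' := rfl
  map_add' := p.toCompletion_add
  commutes' c := by
    rw [Algebra.algebraMap_eq_smul_one, Algebra.algebraMap_eq_smul_one]
    exact p.toCompletion_smul c 1
  map_star' x := (p.star_toCompletion x).symm

end

variable {B D : Type u} [CStarAlgebra B] [CStarAlgebra D] (p : CStarSeminorm (B ⊗[ℂ] D))

/-- `b ↦ b ⊗ 1`, as a map to the completion. -/
def inl : B →⋆ₐ[ℂ] p.Completion := p.toCompletionHom.comp (StarRep.inl B D)

/-- `d ↦ 1 ⊗ d`, as a map to the completion. -/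
def inr : D →⋆ₐ[ℂ] p.Completion := p.toCompletionHom.comp (StarRep.inr B D)

theorem inl_mul_inr (b : B) (d : D) : p.inl b * p.inr d = p.toCompletion (b ⊗ₜ d) := by
  change p.toCompletion (b ⊗ₜ 1) * p.toCompletion (1 ⊗ₜ d) = _
  rw [← toCompletion_mul]
  simp

theorem commute_inl_inr (b : B) (d : D) : Commute (p.inl b) (p.inr d) := by
  change p.toCompletion (b ⊗ₜ 1) * p.toCompletion (1 ⊗ₜ d) =
    p.toCompletion (1 ⊗ₜ d) * p.toCompletion (b ⊗ₜ 1)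
  rw [← toCompletion_mul, ← toCompletion_mul]
  simp

end CStarSeminorm

theorem StarAlgHom.continuous_of_cstarAlgebra {A C : Type*} [CStarAlgebra A] [CStarAlgebra C]
    (φ : A →⋆ₐ[ℂ] C) : Continuous φ :=
  AddMonoidHomClass.continuous_of_bound φ 1 fun a => by
    rw [one_mul]; exact NonUnitalStarAlgHom.norm_apply_le φ a

/-! ### Vectors central for one of two commuting subalgebras -/

namespace HilbertBimodule

section General

variable {A : Type u} [CStarAlgebra A] (H : HilbertBimodule A)

theorem left_right_comm (a : A) (b : Aᵐᵒᵖ) (ξ : H.space) :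
    H.left a (H.right b ξ) = H.right b (H.left a ξ) :=
  DFunLike.congr_fun (H.commute a b).eq ξ

theorem continuous_left (ξ : H.space) : Continuous fun a => H.left a ξ :=
  (ContinuousLinearMap.apply ℂ H.space ξ).continuous.comp H.left.continuous_of_cstarAlgebra

theorem continuous_right (ξ : H.space) : Continuous fun a : A => H.right (op a) ξ :=
  ((ContinuousLinearMap.apply ℂ H.space ξ).continuous.comp
    H.right.continuous_of_cstarAlgebra).comp continuous_op

/-- Normalising a vector of norm at least `1 / 2` enlarges its commutators at most twofold, whence
the tolerance `ε / 2`. -/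
theorem norm_inv_smul_mem_almostCentral {F : Finset A} {ε : ℝ} {ξ : H.space} (h : 1 / 2 ≤ ‖ξ‖)
    (hF : ∀ x ∈ F, ‖H.left x ξ - H.right (op x) ξ‖ < ε / 2) :
    ((‖ξ‖⁻¹ : ℝ) : ℂ) • ξ ∈ H.almostCentral F ε := by
  have h0 : 0 < ‖ξ‖ := by linarith
  have hn : ‖((‖ξ‖⁻¹ : ℝ) : ℂ)‖ = ‖ξ‖⁻¹ := by
    rw [Complex.norm_real, norm_inv, norm_norm]
  refine ⟨by rw [norm_smul, hn, inv_mul_cancel₀ h0.ne'], fun x hx => ?_⟩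
  have hx' := hF x hx
  rw [map_smul, map_smul, ← smul_sub, norm_smul, hn, inv_mul_lt_iff₀ h0]
  nlinarith [norm_nonneg (H.left x ξ - H.right (op x) ξ)]

variable {B D : Type u} [CStarAlgebra B] [CStarAlgebra D] (f : B →⋆ₐ[ℂ] A) (g : D →⋆ₐ[ℂ] A)

/-- The vectors of `H` that are central for the image of `f`. -/
def centralAlong : Submodule ℂ H.space := (H.comap f).central

instance : CompleteSpace (H.centralAlong f) := (H.comap f).isClosed_central.completeSpace_coe

variable {f g}

theorem mem_centralAlong {ξ : H.space} :
    ξ ∈ H.centralAlong f ↔ ∀ b, H.left (f b) ξ = H.right (op (f b)) ξ := Iff.rfl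

theorem left_mem_centralAlong {a : A} (ha : ∀ b, Commute (f b) a) {ξ : H.space}
    (hξ : ξ ∈ H.centralAlong f) : H.left a ξ ∈ H.centralAlong f := fun b =>
  calc H.left (f b) (H.left a ξ) = H.left a (H.left (f b) ξ) :=
        DFunLike.congr_fun ((ha b).map H.left).eq ξ
    _ = H.right (op (f b)) (H.left a ξ) := by
        rw [H.mem_centralAlong.1 hξ b, left_right_comm]

theorem right_mem_centralAlong {a : A} (ha : ∀ b, Commute (f b) a) {ξ : H.space}
    (hξ : ξ ∈ H.centralAlong f) : H.right (op a) ξ ∈ H.centralAlong f := fun b =>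
  calc H.left (f b) (H.right (op a) ξ) = H.right (op a) (H.right (op (f b)) ξ) := by
        rw [left_right_comm, H.mem_centralAlong.1 hξ b]
    _ = H.right (op (f b)) (H.right (op a) ξ) :=
        (DFunLike.congr_fun ((ha b).op.map H.right).eq ξ).symm

/-- The central vectors for one subalgebra, as a Hilbert bimodule over a commuting one. -/
def centralBimodule (hfg : ∀ b d, Commute (f b) (g d)) : HilbertBimodule D where
  space := H.centralAlong f
  left := (H.left.comp g).restrictInvariant (H.centralAlong f) fun d _ hξ =>
    H.left_mem_centralAlong (fun b => hfg b d) hξ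
  right := (H.right.comp g.mulOpposite).restrictInvariant (H.centralAlong f) fun d _ hξ =>
    H.right_mem_centralAlong (fun b => hfg b d.unop) hξ
  commute d e := by
    ext ξ
    exact H.left_right_comm (g d) (op (g e.unop)) (ξ : H.space)

/-- The projection commutes with both actions of `g d`, so the commutator of the projected vector is
the projection of the commutator. -/
theorem norm_commutator_starProjection_le (hfg : ∀ b d, Commute (f b) (g d)) (d : D) (ξ : H.space) :
    ‖H.left (g d) ((H.centralAlong f).starProjection ξ) -
        H.right (op (g d)) ((H.centralAlong f).starProjection ξ)‖ ≤
      ‖H.left (g d) ξ - H.right (op (g d)) ξ‖ := by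
  have hl := (H.left.comp g).starProjection_apply_of_invariant (H.centralAlong f)
    (fun d _ hξ => H.left_mem_centralAlong (fun b => hfg b d) hξ) d ξ
  have hr := (H.right.comp g.mulOpposite).starProjection_apply_of_invariant (H.centralAlong f)
    (fun d _ hξ => H.right_mem_centralAlong (fun b => hfg b d.unop) hξ) (op d) ξ
  change _ = H.left (g d) _ at hl
  change _ = H.right (op (g d)) _ at hr
  rw [← hl, ← hr, ← map_sub]
  exact Submodule.norm_starProjection_apply_le _ _

end General

variable {B D : Type u} [CStarAlgebra B] [CStarAlgebra D] {p : CStarSeminorm (B ⊗[ℂ] D)}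
  (H : HilbertBimodule p.Completion)

theorem mem_central_of_inl_inr {ξ : H.space} (hB : ξ ∈ H.centralAlong p.inl)
    (hD : ξ ∈ H.centralAlong p.inr) : ξ ∈ H.central := by
  intro a
  rw [mem_centralAlong] at hB hD
  refine p.denseRange_toCompletion.induction_on
    (p := fun a => H.left a ξ = H.right (op a) ξ) a
    (isClosed_eq (H.continuous_left ξ) (H.continuous_right ξ)) fun x => ?_
  induction x using TensorProduct.induction_on with
  | zero =>
    have h0 : p.toCompletion (0 : B ⊗[ℂ] D) = 0 := rfl
    simp [h0]
  | add x y hx hy =>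
    rw [p.toCompletion_add, map_add, op_add, map_add, add_apply, add_apply, hx, hy]
  | tmul b d =>
    -- Move `d` to the right of `ξ`, pass `b` through the right action, then move `b` across; this
    -- is the order that `op (b * d)` requires.
    rw [← p.inl_mul_inr, map_mul, op_mul, map_mul, mul_apply_eq_comp, mul_apply_eq_comp, hD,
      left_right_comm, hB]

theorem coe_mem_central {ξ : H.centralAlong p.inl}
    (hξ : ξ ∈ (H.centralBimodule p.commute_inl_inr).central) : (ξ : H.space) ∈ H.central :=
  H.mem_central_of_inl_inr ξ.2 fun d => congrArg Subtype.val (hξ d)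

end HilbertBimodule

/-! ### Property (T) passing from the factors to the tensor product -/

section

variable {B D : Type u} [CStarAlgebra B] [CStarAlgebra D]

/-- The common core of both halves of (a): `η` is the normalised projection of `ξ` onto the vectors
central along `f`, and `c` is the norm of that projection, so `c • η` is the projection itself. -/
theorem HasStrongPropertyT.exists_almostCentral_centralBimodule {A : Type u} [CStarAlgebra A]
    {f : B →⋆ₐ[ℂ] A} {g : D →⋆ₐ[ℂ] A} (hfg : ∀ b d, Commute (f b) (g d))
    (hB : HasStrongPropertyT B) {α : ℝ} (hα : 0 < α) (F : Finset D) {ε : ℝ} (hε : 0 < ε) :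
    ∃ G : Finset A, G.Nonempty ∧ ∃ γ : ℝ, 0 < γ ∧ ∀ H : HilbertBimodule A,
      ∀ ξ ∈ H.almostCentral G γ, ∃ η : H.centralAlong f,
        η ∈ (H.centralBimodule hfg).almostCentral F ε ∧
          ∃ c : ℂ, ‖c‖ ≤ 1 ∧ ‖ξ - c • (η : H.space)‖ < α := by
  classical
  -- The bound `1 / 2` keeps the projection of a unit vector away from zero, so that it can be
  -- normalised.
  obtain ⟨Q, hQ, β, hβ, h⟩ := hB (min α (1 / 2)) (by positivity)
  refine ⟨Q.image f ∪ F.image g, (hQ.image f).mono Finset.subset_union_left, min β (ε / 2),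
    by positivity, fun H ξ hξ => ?_⟩
  have h1 : ‖ξ - (H.centralAlong f).starProjection ξ‖ < min α (1 / 2) :=
    h (H.comap f) ξ ⟨hξ.1, fun x hx => (hξ.2 (f x) (Finset.mem_union_left _
      (Finset.mem_image_of_mem f hx))).trans_le (min_le_left _ _)⟩
  have hle : ‖(H.centralAlong f).starProjection ξ‖ ≤ 1 :=
    (Submodule.norm_starProjection_apply_le _ _).trans hξ.1.le
  have hge : 1 / 2 ≤ ‖(H.centralAlong f).starProjection ξ‖ := by
    have := norm_sub_norm_le ξ ((H.centralAlong f).starProjection ξ)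
    have := h1.trans_le (min_le_right _ _)
    linarith [hξ.1]
  have hc : ∀ x ∈ F, ‖H.left (g x) ((H.centralAlong f).starProjection ξ) -
      H.right (op (g x)) ((H.centralAlong f).starProjection ξ)‖ < ε / 2 := fun x hx =>
    (H.norm_commutator_starProjection_le hfg x ξ).trans_lt ((hξ.2 (g x) (Finset.mem_union_right _
      (Finset.mem_image_of_mem g hx))).trans_le (min_le_right _ _))
  let ζ : H.centralAlong f := ⟨_, (H.centralAlong f).starProjection_apply_mem ξ⟩
  have hζ : (ζ : H.space) = (H.centralAlong f).starProjection ξ := rfl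
  rw [← hζ] at h1 hle hge
  have hn : (‖(ζ : H.space)‖ : ℂ) ≠ 0 := by
    rw [Complex.ofReal_ne_zero]; linarith
  refine ⟨_, (H.centralBimodule hfg).norm_inv_smul_mem_almostCentral (ξ := ζ) hge hc,
    (‖(ζ : H.space)‖ : ℂ), by simpa using hle, ?_⟩
  change ‖ξ - (‖(ζ : H.space)‖ : ℂ) • ((‖(ζ : H.space)‖⁻¹ : ℝ) : ℂ) • (ζ : H.space)‖ < α
  rw [smul_smul, Complex.ofReal_inv, mul_inv_cancel₀ hn, one_smul]
  exact h1.trans_le (min_le_left _ _)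

theorem HasStrongPropertyT.hasPropertyT_completion (hB : HasStrongPropertyT B)
    (hD : HasPropertyT D) (p : CStarSeminorm (B ⊗[ℂ] D)) : HasPropertyT p.Completion := by
  obtain ⟨F, -, ε, hε, hF⟩ := hD
  -- The distance from `ξ` is irrelevant here, so `α = 1` is an arbitrary choice.
  obtain ⟨G, hG, γ, hγ, h⟩ :=
    hB.exists_almostCentral_centralBimodule p.commute_inl_inr one_pos F hε
  refine ⟨G, hG, γ, hγ, fun H ⟨ξ, hξ⟩ => ?_⟩
  obtain ⟨η, hη, -⟩ := h H ξ hξ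
  obtain ⟨ζ, hζ, h0⟩ := Submodule.exists_mem_ne_zero_of_ne_bot (hF (H.centralBimodule p.commute_inl_inr) ⟨η, hη⟩)
  exact Submodule.ne_bot_iff _ |>.2 ⟨_, H.coe_mem_central hζ, fun h => h0 (Subtype.ext h)⟩

theorem HasStrongPropertyT.hasStrongPropertyT_completion (hB : HasStrongPropertyT B)
    (hD : HasStrongPropertyT D) (p : CStarSeminorm (B ⊗[ℂ] D)) :
    HasStrongPropertyT p.Completion := by
  intro α hα
  obtain ⟨F, -, ε, hε, hF⟩ := hD (α / 2) (half_pos hα)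
  obtain ⟨G, hG, γ, hγ, h⟩ :=
    hB.exists_almostCentral_centralBimodule p.commute_inl_inr (half_pos hα) F hε
  refine ⟨G, hG, γ, hγ, fun H ξ hξ => ?_⟩
  obtain ⟨η, hη, c, hc, hξη⟩ := h H ξ hξ
  -- `@id` makes `η` a vector of the bimodule over `D`; the next line reads the same inequality in
  -- `H`.
  obtain ⟨ζ, hζ, h2⟩ : ∃ ζ ∈ (H.centralBimodule p.commute_inl_inr).central,
      ‖@id (H.centralBimodule p.commute_inl_inr).space η - ζ‖ < α / 2 :=
    ⟨_, Submodule.starProjection_apply_mem _ _, hF (H.centralBimodule p.commute_inl_inr) η hη⟩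
  obtain ⟨ζ, hζ, h3⟩ : ∃ ζ ∈ H.central, ‖(η : H.space) - ζ‖ < α / 2 :=
    ⟨_, H.coe_mem_central hζ, h2⟩
  calc ‖ξ - H.central.starProjection ξ‖ ≤ ‖ξ - c • ζ‖ :=
        Submodule.norm_sub_starProjection_le _ _ (H.central.smul_mem c hζ)
    _ = ‖(ξ - c • (η : H.space)) + c • ((η : H.space) - ζ)‖ := by rw [smul_sub]; congr 1; abel
    _ ≤ ‖ξ - c • (η : H.space)‖ + ‖c‖ * ‖(η : H.space) - ζ‖ := by
        rw [← norm_smul]; exact norm_add_le _ _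
    _ < α / 2 + α / 2 := by
        refine add_lt_add_of_lt_of_le hξη ?_
        exact (mul_le_of_le_one_left (norm_nonneg _) hc).trans h3.le
    _ = α := add_halves α

/-- A net almost central for `A` is almost central for `D` after pullback along `g`, so `A` has none
either and strong (T) is vacuous. -/
theorem hasStrongPropertyT_of_map {A : Type u} [CStarAlgebra A] (g : D →⋆ₐ[ℂ] A)
    (h : ∀ K : HilbertBimodule D, ¬ K.HasAlmostCentralUnitVector) : HasStrongPropertyT A :=
  hasStrongPropertyT_of_forall_not fun H ⟨I, h1, h2, h3, ξ, hξ, hlim⟩ =>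
    h (H.comap g) ⟨I, h1, h2, h3, ξ, hξ, fun d => hlim (g d)⟩

end

/-! ### Tensor products of Hilbert bimodules -/

namespace CStarSeminorm

variable {X C : Type u} [Ring X] [StarRing X] [Algebra ℂ X] [CStarAlgebra C]
  (p : CStarSeminorm X) (φ : X →⋆ₐ[ℂ] C)

theorem exists_lift (hφ : ∀ x, ‖φ x‖ ≤ p.toSeminorm x) :
    ∃ Φ : p.Completion →⋆ₐ[ℂ] C, ∀ x, Φ (p.toCompletion x) = φ x := by
  let ψ : p.Carrier →+* C := (φ : X →+* C)
  have hψ : Continuous ψ := AddMonoidHomClass.continuous_of_bound ψ 1 fun x => by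
    rw [one_mul]; exact hφ x
  let Ψ : p.Completion →+* C := UniformSpace.Completion.extensionHom ψ hψ
  have hΨ : Continuous Ψ := UniformSpace.Completion.continuous_extension
  have hcoe : ∀ x : X, Ψ (p.toCompletion x) = φ x :=
    fun x => UniformSpace.Completion.extensionHom_coe ψ hψ x
  refine ⟨{ Ψ with commutes' := fun c => ?_, map_star' := fun a => ?_ }, hcoe⟩
  · have h := hcoe (algebraMap ℂ X c)
    rw [AlgHomClass.commutes] at h
    rw [← h]
    exact congrArg _ (AlgHomClass.commutes p.toCompletionHom c).symm
  · refine p.denseRange_toCompletion.induction_on (p := fun a => Ψ (star a) = star (Ψ a)) a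
      (isClosed_eq (hΨ.comp p.continuous_star_completion) (continuous_star.comp hΨ)) fun x => ?_
    rw [p.star_toCompletion, hcoe, hcoe, map_star]

/-- The extension to the completion of a ⋆-homomorphism dominated by a C⋆-seminorm. -/
def lift (hφ : ∀ x, ‖φ x‖ ≤ p.toSeminorm x) : p.Completion →⋆ₐ[ℂ] C :=
  (p.exists_lift φ hφ).choose

theorem lift_toCompletion (hφ : ∀ x, ‖φ x‖ ≤ p.toSeminorm x) (x : X) :
    p.lift φ hφ (p.toCompletion x) = φ x :=
  (p.exists_lift φ hφ).choose_spec x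

end CStarSeminorm

/-- Polarisation: conjugate-linearity exchanges the terms with `I` and `-I`, which amounts to
exchanging `x` and `y`. -/
theorem LinearIsometryEquiv.inner_map_map_conj {E F : Type*} [NormedAddCommGroup E]
    [InnerProductSpace ℂ E] [NormedAddCommGroup F] [InnerProductSpace ℂ F] (J : E ≃ₗᵢ⋆[ℂ] F)
    (x y : E) : ⟪J x, J y⟫_ℂ = ⟪y, x⟫_ℂ := by
  have h1 : J x - Complex.I • J y = J (x + Complex.I • y) := by
    rw [map_add, LinearIsometryEquiv.map_smulₛₗ]; simp [sub_eq_add_neg]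
  have h2 : J x + Complex.I • J y = J (x - Complex.I • y) := by
    rw [map_sub, LinearIsometryEquiv.map_smulₛₗ]; simp [sub_eq_add_neg]
  have h3 := inner_eq_sum_norm_sq_div_four (𝕜 := ℂ) (J x) (J y)
  have h4 := inner_eq_sum_norm_sq_div_four (𝕜 := ℂ) y x
  have h5 : ‖y - Complex.I • x‖ = ‖x + Complex.I • y‖ := by
    rw [← norm_neg (y - _), ← one_mul ‖x + _‖, ← Complex.norm_I, ← norm_smul, smul_add, smul_smul,
      Complex.I_mul_I, neg_one_smul, neg_sub, sub_eq_add_neg]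
  have h6 : ‖y + Complex.I • x‖ = ‖x - Complex.I • y‖ := by
    rw [← one_mul ‖x - _‖, ← Complex.norm_I, ← norm_smul, smul_sub, smul_smul,
      Complex.I_mul_I, neg_one_smul, sub_neg_eq_add, add_comm]
  simp only [RCLike.I_to_complex] at h3 h4
  rw [h1, h2, ← map_add, ← map_sub] at h3
  simp only [LinearIsometryEquiv.norm_map] at h3
  rw [h3, h4, h5, h6, add_comm y, norm_sub_rev y]

/-- Conjugate the coordinates in a Hilbert basis. -/
theorem exists_conjugation (E : Type*) [NormedAddCommGroup E] [InnerProductSpace ℂ E]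
    [CompleteSpace E] : Nonempty (E ≃ₗᵢ⋆[ℂ] E) := by
  obtain ⟨w, b, -⟩ := exists_hilbertBasis ℂ E
  exact ⟨(b.repr.trans (starₗᵢ ℂ)).trans b.repr.symm⟩

/-- The conjugate of a representation of the opposite algebra, transported along an antiunitary
operator. -/
def StarAlgHom.conjugate {A E : Type*} [Ring A] [StarRing A] [Algebra ℂ A] [StarModule ℂ A]
    [NormedAddCommGroup E] [InnerProductSpace ℂ E] [CompleteSpace E]
    (φ : Aᵐᵒᵖ →⋆ₐ[ℂ] (E →L[ℂ] E)) (J : E ≃ₗᵢ⋆[ℂ] E) : A →⋆ₐ[ℂ] (E →L[ℂ] E) where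
  toFun a := ((J : E →L⋆[ℂ] E).comp (φ (op (star a)))).comp (J.symm : E →L⋆[ℂ] E)
  map_one' := by ext; simp
  map_mul' a b := by ext; simp
  map_zero' := by ext; simp
  map_add' a b := by ext; simp
  commutes' c := by
    ext x
    rw [Algebra.algebraMap_eq_smul_one, star_smul, star_one, op_smul, op_one, map_smul, map_one]
    simp [Algebra.algebraMap_eq_smul_one]
  map_star' a := by
    rw [ContinuousLinearMap.star_eq_adjoint, ContinuousLinearMap.eq_adjoint_iff]
    intro x y
    obtain ⟨x, rfl⟩ := J.surjective x
    obtain ⟨y, rfl⟩ := J.surjective y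
    change ⟪J (φ (op (star (star a))) (J.symm (J x))), J y⟫_ℂ =
      ⟪J x, J (φ (op (star a)) (J.symm (J y)))⟫_ℂ
    rw [J.symm_apply_apply, J.symm_apply_apply, J.inner_map_map_conj, J.inner_map_map_conj,
      op_star, op_star]
    exact (φ.inner_apply_left (star (op a)) y x).symm

theorem StarAlgHom.conjugate_apply {A E : Type*} [Ring A] [StarRing A] [Algebra ℂ A]
    [StarModule ℂ A] [NormedAddCommGroup E] [InnerProductSpace ℂ E] [CompleteSpace E]
    (φ : Aᵐᵒᵖ →⋆ₐ[ℂ] (E →L[ℂ] E)) (J : E ≃ₗᵢ⋆[ℂ] E) (a : A) (x : E) :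
    φ.conjugate J a (J x) = J (φ (op (star a)) x) := by
  change J (φ (op (star a)) (J.symm (J x))) = _
  rw [J.symm_apply_apply]

/-- The ⋆-homomorphism on the algebraic tensor product given by two ⋆-homomorphisms with commuting
ranges. -/
def StarAlgHom.tensorLift {B D C : Type*} [CStarAlgebra B] [CStarAlgebra D] [Ring C] [StarRing C]
    [Algebra ℂ C] (f : B →⋆ₐ[ℂ] C) (g : D →⋆ₐ[ℂ] C) (hfg : ∀ b d, Commute (f b) (g d)) :
    B ⊗[ℂ] D →⋆ₐ[ℂ] C where
  __ := Algebra.TensorProduct.lift f.toAlgHom g.toAlgHom hfg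
  map_star' x := by
    change Algebra.TensorProduct.lift f.toAlgHom g.toAlgHom hfg (star x) =
      star (Algebra.TensorProduct.lift f.toAlgHom g.toAlgHom hfg x)
    induction x using TensorProduct.induction_on with
    | zero => simp
    | add x y hx hy => rw [star_add, map_add, map_add, hx, hy, star_add]
    | tmul b d =>
      change f (star b) * g (star d) = star (f b * g d)
      rw [(hfg _ _).eq, star_mul, map_star, map_star]

namespace HilbertBimodule

variable {B D : Type u} [CStarAlgebra B] [CStarAlgebra D] (H : HilbertBimodule B)
  (K : HilbertBimodule D)

/-- The left action of the algebraic tensor product on the tensor product of two bimodules. -/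
def tensorLeftHom : B ⊗[ℂ] D →⋆ₐ[ℂ]
    (HilbertTensor H.space K.space →L[ℂ] HilbertTensor H.space K.space) :=
  StarAlgHom.tensorLift ((ampLeft H.space K.space).comp H.left)
    ((ampRight H.space K.space).comp K.left) fun _ _ => commute_amp _ _

/-- The right action of the algebraic tensor product on the tensor product of two bimodules. -/
def tensorRightHom : B ⊗[ℂ] D →⋆ₐ[ℂ]
    (HilbertTensor H.space K.space →L[ℂ] HilbertTensor H.space K.space)ᵐᵒᵖ :=
  StarAlgHom.tensorLift ((ampLeft H.space K.space).mulOpposite.comp H.right.toOpposite)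
    ((ampRight H.space K.space).mulOpposite.comp K.right.toOpposite)
    fun _ _ => (commute_amp _ _).op

theorem tensorLeftHom_tmul (b : B) (d : D) :
    H.tensorLeftHom K (b ⊗ₜ d) =
      ampLeft H.space K.space (H.left b) * ampRight H.space K.space (K.left d) := rfl

/-- The opposite multiplication reverses the two amplifications, which commute. -/
theorem unop_tensorRightHom_tmul (b : B) (d : D) :
    (H.tensorRightHom K (b ⊗ₜ d)).unop =
      ampLeft H.space K.space (H.right (op b)) * ampRight H.space K.space (K.right (op d)) :=
  (commute_amp _ _).symm.eq

/-- By definition this is the tensor product of two representations, one of those over which the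
minimal norm is the supremum. -/
theorem norm_tensorLift_amp_le {E F : Type u} [NormedAddCommGroup E] [InnerProductSpace ℂ E]
    [CompleteSpace E] [NormedAddCommGroup F] [InnerProductSpace ℂ F] [CompleteSpace F]
    (φ : B →⋆ₐ[ℂ] (E →L[ℂ] E)) (ψ : D →⋆ₐ[ℂ] (F →L[ℂ] F)) (x : B ⊗[ℂ] D) :
    ‖StarAlgHom.tensorLift ((ampLeft E F).comp φ) ((ampRight E F).comp ψ)
      (fun _ _ => commute_amp _ _) x‖ ≤ (minCStarSeminorm B D).toSeminorm x :=
  le_ciSup (StarRep.bddAbove_tensor B D (fun q : StarRep B × StarRep D => q.1.tensor q.2) x)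
    (⟨E, φ⟩, ⟨F, ψ⟩)

theorem norm_tensorLeftHom_le (x : B ⊗[ℂ] D) :
    ‖H.tensorLeftHom K x‖ ≤ (minCStarSeminorm B D).toSeminorm x :=
  norm_tensorLift_amp_le H.left K.left x

theorem inner_map_conj_tmul {E F : Type u} [NormedAddCommGroup E] [InnerProductSpace ℂ E]
    [NormedAddCommGroup F] [InnerProductSpace ℂ F] (J : E ≃ₗᵢ⋆[ℂ] E) (L : F ≃ₗᵢ⋆[ℂ] F)
    (x y : E ⊗[ℂ] F) :
    ⟪TensorProduct.map (J : E →ₛₗ[starRingEnd ℂ] E) (L : F →ₛₗ[starRingEnd ℂ] F) x,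
      TensorProduct.map (J : E →ₛₗ[starRingEnd ℂ] E) (L : F →ₛₗ[starRingEnd ℂ] F) y⟫_ℂ =
        ⟪y, x⟫_ℂ := by
  induction x using TensorProduct.induction_on with
  | zero => simp
  | add x x' hx hx' => rw [map_add, inner_add_left, inner_add_right, hx, hx']
  | tmul e f =>
    induction y using TensorProduct.induction_on with
    | zero => simp
    | add y y' hy hy' => rw [map_add, inner_add_left, inner_add_right, hy, hy']
    | tmul e' f' =>
      simp [LinearIsometryEquiv.inner_map_map_conj]

theorem norm_map_conj {E F : Type u} [NormedAddCommGroup E] [InnerProductSpace ℂ E]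
    [NormedAddCommGroup F] [InnerProductSpace ℂ F] (J : E ≃ₗᵢ⋆[ℂ] E) (L : F ≃ₗᵢ⋆[ℂ] F)
    (x : E ⊗[ℂ] F) :
    ‖TensorProduct.map (J : E →ₛₗ[starRingEnd ℂ] E) (L : F →ₛₗ[starRingEnd ℂ] F) x‖ = ‖x‖ := by
  rw [norm_eq_sqrt_re_inner (𝕜 := ℂ), inner_map_conj_tmul]
  exact (norm_eq_sqrt_re_inner (𝕜 := ℂ) x).symm

theorem opNorm_le_of_incl {E F : Type u} [NormedAddCommGroup E]
    [InnerProductSpace ℂ E] [NormedAddCommGroup F] [InnerProductSpace ℂ F]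
    (T : HilbertTensor E F →L[ℂ] HilbertTensor E F) {M : ℝ} (hM : 0 ≤ M)
    (h : ∀ z, ‖T (HilbertTensor.incl E F z)‖ ≤ M * ‖z‖) : ‖T‖ ≤ M := by
  refine T.opNorm_le_bound hM fun y => HilbertTensor.denseRange_incl.induction_on
    (p := fun y => ‖T y‖ ≤ M * ‖y‖) y (isClosed_le (by fun_prop) (by fun_prop)) fun z => ?_
  rw [LinearIsometry.norm_map]
  exact h z

/-- The right action reverses products, so it is not among the representations defining the minimal
norm. Conjugating `y ↦ H.tensorRightHom K (star y)` by the antiunitary `J ⊗ L` yields `Θ`, a tensor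
product of representations of `B` and `D`, which is among them. Antiunitary operators and the
involution do not affect the bound. -/
theorem norm_tensorRightHom_le (x : B ⊗[ℂ] D) :
    ‖H.tensorRightHom K x‖ ≤ (minCStarSeminorm B D).toSeminorm x := by
  obtain ⟨J⟩ := exists_conjugation H.space
  obtain ⟨L⟩ := exists_conjugation K.space
  let Θ := StarAlgHom.tensorLift ((ampLeft H.space K.space).comp (H.right.conjugate J))
    ((ampRight H.space K.space).comp (K.right.conjugate L)) fun _ _ => commute_amp _ _
  let W := TensorProduct.map (J : H.space →ₛₗ[starRingEnd ℂ] H.space)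
    (L : K.space →ₛₗ[starRingEnd ℂ] K.space)
  -- Both operators preserve the algebraic tensor product, so the intertwining relation is stated
  -- there through the image `w`, and `W` need not be extended to the completion.
  have key : ∀ (y : B ⊗[ℂ] D) (z : H.space ⊗[ℂ] K.space), ∃ w,
      (H.tensorRightHom K (star y)).unop (HilbertTensor.incl H.space K.space z) =
        HilbertTensor.incl H.space K.space w ∧
      Θ y (HilbertTensor.incl H.space K.space (W z)) =
        HilbertTensor.incl H.space K.space (W w) := by
    intro y z
    induction y using TensorProduct.induction_on with
    | zero => exact ⟨0, by simp⟩
    | add y y' hy hy' =>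
      obtain ⟨w, h1, h2⟩ := hy
      obtain ⟨w', h1', h2'⟩ := hy'
      refine ⟨w + w', ?_, ?_⟩
      · rw [star_add, map_add, unop_add, add_apply, h1, h1', map_add]
      · rw [map_add, add_apply, h2, h2', map_add W, map_add]
    | tmul b d =>
      refine ⟨(H.right (op (star b))).rTensor K.space ((K.right (op (star d))).lTensor H.space z),
        ?_, ?_⟩
      · rw [TensorProduct.star_tmul, unop_tensorRightHom_tmul, mul_apply_eq_comp, ampRight_incl,
          ampLeft_incl]
      · change (ampLeft H.space K.space (H.right.conjugate J b) *
          ampRight H.space K.space (K.right.conjugate L d)) _ = _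
        rw [mul_apply_eq_comp, ampRight_incl, ampLeft_incl]
        congr 1
        induction z using TensorProduct.induction_on with
        | zero => simp
        | add z z' hz hz' => simp only [map_add, hz, hz']
        | tmul e f =>
          change (H.right.conjugate J b (J e)) ⊗ₜ (K.right.conjugate L d (L f)) =
            J (H.right (op (star b)) e) ⊗ₜ L (K.right (op (star d)) f)
          rw [StarAlgHom.conjugate_apply, StarAlgHom.conjugate_apply]
  have hstar : ∀ y, ‖H.tensorRightHom K (star y)‖ ≤ (minCStarSeminorm B D).toSeminorm y := by
    intro y
    refine opNorm_le_of_incl (H.tensorRightHom K (star y)).unop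
      (apply_nonneg _ _) fun z => ?_
    obtain ⟨w, h1, h2⟩ := key y z
    rw [h1, LinearIsometry.norm_map, ← norm_map_conj J L w, ← norm_map_conj J L z,
      ← (HilbertTensor.incl H.space K.space).norm_map,
      ← (HilbertTensor.incl H.space K.space).norm_map]
    change ‖HilbertTensor.incl H.space K.space (W w)‖ ≤
      _ * ‖HilbertTensor.incl H.space K.space (W z)‖
    rw [← h2]
    exact (Θ y).le_of_opNorm_le (norm_tensorLift_amp_le _ _ y) _
  have := hstar (star x)
  rw [star_star] at this
  exact this.trans ((minCStarSeminorm B D).star_le x)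

/-- The tensor product of two Hilbert bimodules, as a Hilbert bimodule over the minimal tensor
product. -/
def tensor : HilbertBimodule (MinTensor B D) where
  space := HilbertTensor H.space K.space
  left := (minCStarSeminorm B D).lift (H.tensorLeftHom K) (H.norm_tensorLeftHom_le K)
  right := ((minCStarSeminorm B D).lift (H.tensorRightHom K)
    (H.norm_tensorRightHom_le K)).fromOpposite
  commute a b := by
    have hl := ((minCStarSeminorm B D).lift (H.tensorLeftHom K)
      (H.norm_tensorLeftHom_le K)).continuous_of_cstarAlgebra
    have hr := continuous_unop.comp ((minCStarSeminorm B D).lift (H.tensorRightHom K)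
      (H.norm_tensorRightHom_le K)).continuous_of_cstarAlgebra
    refine (minCStarSeminorm B D).denseRange_toCompletion.induction_on₂
      (p := fun a c => Commute ((minCStarSeminorm B D).lift (H.tensorLeftHom K)
        (H.norm_tensorLeftHom_le K) a) (((minCStarSeminorm B D).lift (H.tensorRightHom K)
          (H.norm_tensorRightHom_le K) c).unop))
      (isClosed_eq ((hl.comp continuous_fst).mul (hr.comp continuous_snd))
        ((hr.comp continuous_snd).mul (hl.comp continuous_fst))) (fun x y => ?_) a b.unop
    rw [CStarSeminorm.lift_toCompletion, CStarSeminorm.lift_toCompletion]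
    induction x using TensorProduct.induction_on with
    | zero => rw [map_zero]; exact Commute.zero_left _
    | add x x' hx hx' => rw [map_add]; exact hx.add_left hx'
    | tmul b d =>
      induction y using TensorProduct.induction_on with
      | zero => rw [map_zero]; exact Commute.zero_right _
      | add y y' hy hy' => rw [map_add]; exact hy.add_right hy'
      | tmul b' d' =>
        rw [tensorLeftHom_tmul, unop_tensorRightHom_tmul]
        -- Operators on different legs commute as amplifications; on the same leg the bimodule axiom
        -- applies.
        refine Commute.mul_left (Commute.mul_right ?_ (commute_amp _ _))
          (Commute.mul_right (commute_amp _ _).symm ?_)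
        · exact (H.commute b (op b')).map (ampLeft H.space K.space)
        · exact (K.commute d (op d')).map (ampRight H.space K.space)

/-- The elementary tensor `ξ ⊗ η` in the tensor product of two bimodules. -/
def tmul (ξ : H.space) (η : K.space) : (H.tensor K).space :=
  HilbertTensor.incl H.space K.space (ξ ⊗ₜ η)

end HilbertBimodule

/-! ### Almost central vectors in tensor products -/

namespace HilbertBimodule

variable {B D : Type u} [CStarAlgebra B] [CStarAlgebra D] (H : HilbertBimodule B)
  (K : HilbertBimodule D)

theorem norm_tmul (ξ : H.space) (η : K.space) : ‖H.tmul K ξ η‖ = ‖ξ‖ * ‖η‖ :=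
  ((HilbertTensor.incl H.space K.space).norm_map _).trans (TensorProduct.norm_tmul ξ η)

theorem inner_tmul (ξ ξ' : H.space) (η η' : K.space) :
    ⟪H.tmul K ξ η, H.tmul K ξ' η'⟫_ℂ = ⟪ξ, ξ'⟫_ℂ * ⟪η, η'⟫_ℂ :=
  ((HilbertTensor.incl H.space K.space).inner_map_map _ _).trans
    (TensorProduct.inner_tmul (𝕜 := ℂ) ξ ξ' η η')

theorem tmul_sub_tmul (ξ ξ' : H.space) (η η' : K.space) :
    H.tmul K ξ η - H.tmul K ξ' η' = H.tmul K (ξ - ξ') η + H.tmul K ξ' (η - η') := by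
  have : ξ ⊗ₜ[ℂ] η - ξ' ⊗ₜ η' = (ξ - ξ') ⊗ₜ η + ξ' ⊗ₜ (η - η') := by
    rw [TensorProduct.sub_tmul, TensorProduct.tmul_sub]; abel
  have h := congrArg (HilbertTensor.incl H.space K.space) this
  rw [map_sub, map_add] at h
  exact h

theorem left_tmul (b : B) (d : D) (ξ : H.space) (η : K.space) :
    (H.tensor K).left ((minCStarSeminorm B D).toCompletion (b ⊗ₜ d)) (H.tmul K ξ η) =
      H.tmul K (H.left b ξ) (K.left d η) := by
  have h := DFunLike.congr_fun (((minCStarSeminorm B D).lift_toCompletion (H.tensorLeftHom K)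
    (H.norm_tensorLeftHom_le K) (b ⊗ₜ d)).trans (H.tensorLeftHom_tmul K b d))
      (HilbertTensor.incl H.space K.space (ξ ⊗ₜ η))
  rw [mul_apply_eq_comp, ampRight_incl, ampLeft_incl] at h
  exact h

theorem right_tmul (b : B) (d : D) (ξ : H.space) (η : K.space) :
    (H.tensor K).right (op ((minCStarSeminorm B D).toCompletion (b ⊗ₜ d))) (H.tmul K ξ η) =
      H.tmul K (H.right (op b) ξ) (K.right (op d) η) := by
  have h := DFunLike.congr_fun ((congrArg unop ((minCStarSeminorm B D).lift_toCompletion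
    (H.tensorRightHom K) (H.norm_tensorRightHom_le K) (b ⊗ₜ d))).trans
      (H.unop_tensorRightHom_tmul K b d)) (HilbertTensor.incl H.space K.space (ξ ⊗ₜ η))
  rw [mul_apply_eq_comp, ampRight_incl, ampLeft_incl] at h
  exact h

theorem norm_left_apply_le {A : Type u} [CStarAlgebra A] (H : HilbertBimodule A) (a : A)
    (ξ : H.space) : ‖H.left a ξ‖ ≤ ‖a‖ * ‖ξ‖ :=
  (H.left a).le_of_opNorm_le (NonUnitalStarAlgHom.norm_apply_le H.left a) ξ

theorem norm_right_apply_le {A : Type u} [CStarAlgebra A] (H : HilbertBimodule A) (a : A)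
    (ξ : H.space) : ‖H.right (op a) ξ‖ ≤ ‖a‖ * ‖ξ‖ :=
  (H.right (op a)).le_of_opNorm_le (NonUnitalStarAlgHom.norm_apply_le H.right (op a)) ξ

/-- For `b ⊗ d`, changing one leg at a time bounds the commutator by those of `b` at `ξ` and of `d`
at `η`, weighted by `‖d‖` and `‖b‖`. The tolerance depends on `x` and `ε` alone, not on the
bimodules. -/
theorem exists_norm_commutator_tmul_lt_of_algebraic (x : B ⊗[ℂ] D) {ε : ℝ} (hε : 0 < ε) :
    ∃ (Q : Finset B) (R : Finset D) (δ : ℝ), 0 < δ ∧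
      ∀ (H : HilbertBimodule B) (K : HilbertBimodule D), ∀ ξ ∈ H.almostCentral Q δ,
        ∀ η ∈ K.almostCentral R δ,
          ‖(H.tensor K).left ((minCStarSeminorm B D).toCompletion x) (H.tmul K ξ η) -
            (H.tensor K).right (op ((minCStarSeminorm B D).toCompletion x)) (H.tmul K ξ η)‖
              < ε := by
  classical
  induction x using TensorProduct.induction_on generalizing ε with
  | zero =>
    refine ⟨∅, ∅, 1, one_pos, fun H K ξ _ η _ => ?_⟩
    have h0 : (minCStarSeminorm B D).toCompletion 0 = 0 := rfl
    simpa [h0] using hε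
  | add x y hx hy =>
    obtain ⟨Q, R, δ, hδ, h⟩ := hx (half_pos hε)
    obtain ⟨Q', R', δ', hδ', h'⟩ := hy (half_pos hε)
    refine ⟨Q ∪ Q', R ∪ R', min δ δ', lt_min hδ hδ', fun H K ξ hξ η hη => ?_⟩
    have h1 := h H K ξ (H.almostCentral_subset Finset.subset_union_left (min_le_left _ _) hξ)
      η (K.almostCentral_subset Finset.subset_union_left (min_le_left _ _) hη)
    have h2 := h' H K ξ (H.almostCentral_subset Finset.subset_union_right (min_le_right _ _) hξ)
      η (K.almostCentral_subset Finset.subset_union_right (min_le_right _ _) hη)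
    rw [CStarSeminorm.toCompletion_add, map_add, op_add, map_add, add_apply, add_apply,
      add_sub_add_comm]
    exact (norm_add_le _ _).trans_lt (by linarith)
  | tmul b d =>
    -- The summand `1` keeps the denominator positive and makes the final estimate strict.
    have hpos : 0 < ‖b‖ + ‖d‖ + 1 := by positivity
    refine ⟨{b}, {d}, ε / (‖b‖ + ‖d‖ + 1), div_pos hε hpos, fun H K ξ hξ η hη => ?_⟩
    have h1 := hξ.2 b (Finset.mem_singleton_self b)
    have h2 := hη.2 d (Finset.mem_singleton_self d)
    have h3 := K.norm_left_apply_le d η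
    have h4 := H.norm_right_apply_le b ξ
    rw [hη.1, mul_one] at h3
    rw [hξ.1, mul_one] at h4
    rw [left_tmul, right_tmul, tmul_sub_tmul]
    set δ := ε / (‖b‖ + ‖d‖ + 1) with hδ
    have hδ0 : 0 < δ := div_pos hε hpos
    calc _ ≤ ‖H.left b ξ - H.right (op b) ξ‖ * ‖K.left d η‖ +
          ‖H.right (op b) ξ‖ * ‖K.left d η - K.right (op d) η‖ := by
          refine (norm_add_le _ _).trans_eq ?_
          rw [norm_tmul, norm_tmul]
      _ ≤ δ * ‖d‖ + ‖b‖ * δ := by gcongr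
      _ < δ * (‖b‖ + ‖d‖ + 1) := by linarith
      _ = ε := div_mul_cancel₀ ε hpos.ne'

/-- Both actions are contractive, so an algebraic `x` within `ε / 3` of `a` costs `ε / 3` on each
side. -/
theorem exists_norm_commutator_tmul_lt (a : MinTensor B D) {ε : ℝ} (hε : 0 < ε) :
    ∃ (Q : Finset B) (R : Finset D) (δ : ℝ), 0 < δ ∧
      ∀ (H : HilbertBimodule B) (K : HilbertBimodule D), ∀ ξ ∈ H.almostCentral Q δ,
        ∀ η ∈ K.almostCentral R δ,
          ‖(H.tensor K).left a (H.tmul K ξ η) - (H.tensor K).right (op a) (H.tmul K ξ η)‖ < ε := by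
  obtain ⟨x, hx⟩ := (minCStarSeminorm B D).denseRange_toCompletion.exists_dist_lt a
    (show 0 < ε / 3 by positivity)
  obtain ⟨Q, R, δ, hδ, h⟩ := exists_norm_commutator_tmul_lt_of_algebraic x
    (show 0 < ε / 3 by positivity)
  refine ⟨Q, R, δ, hδ, fun H K ξ hξ η hη => ?_⟩
  have h1 := h H K ξ hξ η hη
  rw [dist_eq_norm] at hx
  set c := (minCStarSeminorm B D).toCompletion x
  have hn : ‖H.tmul K ξ η‖ = 1 := by rw [norm_tmul, hξ.1, hη.1, one_mul]
  have h2 := (H.tensor K).norm_left_apply_le (a - c) (H.tmul K ξ η)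
  have h3 := (H.tensor K).norm_right_apply_le (a - c) (H.tmul K ξ η)
  rw [hn, mul_one, map_sub, sub_apply] at h2
  rw [hn, mul_one, op_sub, map_sub, sub_apply] at h3
  generalize (H.tensor K).left a (H.tmul K ξ η) = u at *
  generalize (H.tensor K).left c (H.tmul K ξ η) = v at *
  generalize (H.tensor K).right (op a) (H.tmul K ξ η) = u' at *
  generalize (H.tensor K).right (op c) (H.tmul K ξ η) = v' at *
  calc ‖u - u'‖ = ‖(u - v) + (v - v') - (u' - v')‖ := by congr 1; abel
    _ ≤ ‖u - v‖ + ‖v - v'‖ + ‖u' - v'‖ :=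
        (norm_sub_le _ _).trans (add_le_add_left (norm_add_le _ _) _)
    _ < ε := by linarith

theorem exists_tmul_mem_almostCentral (F : Finset (MinTensor B D)) {ε : ℝ} (hε : 0 < ε) :
    ∃ Q : Finset B, Q.Nonempty ∧ ∃ (R : Finset D) (δ : ℝ), 0 < δ ∧
      ∀ (H : HilbertBimodule B) (K : HilbertBimodule D), ∀ ξ ∈ H.almostCentral Q δ,
        ∀ η ∈ K.almostCentral R δ, H.tmul K ξ η ∈ (H.tensor K).almostCentral F ε := by
  classical
  induction F using Finset.induction_on with
  | empty =>
    -- Property (T) of `B` asks for a non-empty `Q`, and `{0}` imposes no condition; `R` may stay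
    -- empty.
    refine ⟨{0}, Finset.singleton_nonempty 0, ∅, 1, one_pos, fun H K ξ hξ η hη => ⟨?_, by simp⟩⟩
    rw [norm_tmul, hξ.1, hη.1, one_mul]
  | insert a F _ ih =>
    obtain ⟨Q, hQ, R, δ, hδ, h⟩ := ih
    obtain ⟨Q', R', δ', hδ', h'⟩ := exists_norm_commutator_tmul_lt a hε
    refine ⟨Q ∪ Q', hQ.mono Finset.subset_union_left, R ∪ R', min δ δ', lt_min hδ hδ',
      fun H K ξ hξ η hη => ?_⟩
    have h1 := h H K ξ (H.almostCentral_subset Finset.subset_union_left (min_le_left _ _) hξ)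
      η (K.almostCentral_subset Finset.subset_union_left (min_le_left _ _) hη)
    have h2 := h' H K ξ (H.almostCentral_subset Finset.subset_union_right (min_le_right _ _) hξ)
      η (K.almostCentral_subset Finset.subset_union_right (min_le_right _ _) hη)
    exact ⟨h1.1, Finset.forall_mem_insert _ _ _ |>.2 ⟨h2, h1.2⟩⟩

/-! ### Slicing vectors of a tensor product -/

/-- The map `ξ ↦ ξ ⊗ η`. -/
def tmulRight (η : K.space) : H.space →L[ℂ] (H.tensor K).space :=
  (HilbertTensor.incl H.space K.space).toContinuousLinearMap.comp
    ((TensorProduct.mkL ℂ H.space K.space).flip η)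

theorem tmulRight_apply (η : K.space) (ξ : H.space) : H.tmulRight K η ξ = H.tmul K ξ η := rfl

theorem norm_adjoint_tmulRight_le (η : K.space) :
    ‖ContinuousLinearMap.adjoint (H.tmulRight K η)‖ ≤ ‖η‖ := by
  rw [LinearIsometryEquiv.norm_map]
  refine ContinuousLinearMap.opNorm_le_bound _ (norm_nonneg _) fun ξ => ?_
  rw [tmulRight_apply, norm_tmul, mul_comm]

/-- For a unit vector `η` the map `ξ ↦ ξ ⊗ η` is an isometry, so its adjoint is a left inverse. -/
theorem adjoint_tmulRight_tmul {η : K.space} (hη : ‖η‖ = 1) (ξ : H.space) :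
    ContinuousLinearMap.adjoint (H.tmulRight K η) (H.tmul K ξ η) = ξ := by
  refine ext_inner_right ℂ fun v => ?_
  rw [ContinuousLinearMap.adjoint_inner_left, tmulRight_apply, inner_tmul,
    inner_self_eq_norm_sq_to_K, hη]
  simp

/-- The map `ξ ↦ ξ ⊗ η` intertwines both actions of `star b` with those of `star b ⊗ 1`; hence its
adjoint intertwines the actions of `b ⊗ 1` with those of `b`, and the two actions of `b ⊗ 1` agree
on `ζ`. -/
theorem adjoint_tmulRight_mem_central {ζ : (H.tensor K).space} (hζ : ζ ∈ (H.tensor K).central)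
    (η : K.space) : ContinuousLinearMap.adjoint (H.tmulRight K η) ζ ∈ H.central := by
  intro b
  refine ext_inner_right ℂ fun v => ?_
  have hl := left_tmul H K (star b) 1 v η
  have hr := right_tmul H K (star b) 1 v η
  have hs : (minCStarSeminorm B D).toCompletion (star b ⊗ₜ 1) =
      star ((minCStarSeminorm B D).toCompletion (b ⊗ₜ 1)) := by
    rw [CStarSeminorm.star_toCompletion, TensorProduct.star_tmul, star_one]
  rw [hs, map_one, one_apply_eq_self] at hl
  rw [hs, op_one, map_one, one_apply_eq_self] at hr
  rw [StarAlgHom.inner_apply_left, StarAlgHom.inner_apply_left,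
    ContinuousLinearMap.adjoint_inner_left, ContinuousLinearMap.adjoint_inner_left,
    tmulRight_apply, tmulRight_apply, ← hl, ← op_star, ← hr, op_star,
    ← StarAlgHom.inner_apply_left, ← StarAlgHom.inner_apply_left, hζ]

/-- Vanishing slices make `ζ` orthogonal to all elementary tensors, whose span is dense. -/
theorem eq_zero_of_adjoint_tmulRight {ζ : (H.tensor K).space}
    (h : ∀ η, ContinuousLinearMap.adjoint (H.tmulRight K η) ζ = 0) : ζ = 0 := by
  have h1 : ∀ z, ⟪ζ, (HilbertTensor.incl H.space K.space z : (H.tensor K).space)⟫_ℂ = 0 := by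
    intro z
    induction z using TensorProduct.induction_on with
    | zero => rw [map_zero]; exact inner_zero_right ζ
    | add x y hx hy =>
      rw [map_add]
      exact (inner_add_right ζ _ _).trans (by rw [hx, hy, add_zero])
    | tmul ξ η =>
      change ⟪ζ, H.tmulRight K η ξ⟫_ℂ = 0
      rw [← ContinuousLinearMap.adjoint_inner_left, h, inner_zero_left]
  have h2 : ∀ y : (H.tensor K).space, ⟪ζ, y⟫_ℂ = 0 := fun y =>
    HilbertTensor.denseRange_incl.induction_on
      (p := fun y : HilbertTensor H.space K.space => ⟪ζ, (y : (H.tensor K).space)⟫_ℂ = 0) y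
      (isClosed_eq (Continuous.inner continuous_const continuous_id) continuous_const) h1
  exact inner_self_eq_zero.1 (h2 ζ)

end HilbertBimodule

/-! ### Property (T) passing from the minimal tensor product to a factor -/

section

variable {B D : Type u} [CStarAlgebra B] [CStarAlgebra D]

theorem HasPropertyT.of_minTensor (h : HasPropertyT (MinTensor B D)) {K : HilbertBimodule D}
    (hK : K.HasAlmostCentralUnitVector) : HasPropertyT B := by
  obtain ⟨F, -, ε, hε, hF⟩ := h
  obtain ⟨Q, hQ, R, δ, hδ, hQR⟩ := HilbertBimodule.exists_tmul_mem_almostCentral F hε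
  obtain ⟨η, hη⟩ := hK.almostCentral_nonempty R hδ
  refine ⟨Q, hQ, δ, hδ, fun H ⟨ξ, hξ⟩ hbot => hF (H.tensor K) ⟨_, hQR H K ξ hξ η hη⟩ ?_⟩
  -- The slice along `η` itself may vanish on a non-zero central vector, so slices along every `ω`
  -- are used.
  refine (Submodule.eq_bot_iff _).2 fun ζ hζ => H.eq_zero_of_adjoint_tmulRight K fun ω => ?_
  have := H.adjoint_tmulRight_mem_central K hζ ω
  rwa [hbot, Submodule.mem_bot] at this

theorem HasStrongPropertyT.of_minTensor (h : HasStrongPropertyT (MinTensor B D))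
    {K : HilbertBimodule D} (hK : K.HasAlmostCentralUnitVector) : HasStrongPropertyT B := by
  intro α hα
  obtain ⟨F, -, ε, hε, hF⟩ := h α hα
  obtain ⟨Q, hQ, R, δ, hδ, hQR⟩ := HilbertBimodule.exists_tmul_mem_almostCentral F hε
  obtain ⟨η, hη⟩ := hK.almostCentral_nonempty R hδ
  refine ⟨Q, hQ, δ, hδ, fun H ξ hξ => ?_⟩
  have h1 := hF (H.tensor K) _ (hQR H K ξ hξ η hη)
  set ζ := (H.tensor K).central.starProjection (H.tmul K ξ η) with hζ
  have hmem : ζ ∈ (H.tensor K).central := Submodule.starProjection_apply_mem _ _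
  -- Here the slice along the given `η` suffices: it is contractive, recovers `ξ`, and sends `ζ` to
  -- a central vector, to which the projection is compared.
  calc ‖ξ - H.central.starProjection ξ‖
      ≤ ‖ξ - ContinuousLinearMap.adjoint (H.tmulRight K η) ζ‖ :=
        Submodule.norm_sub_starProjection_le _ _ (H.adjoint_tmulRight_mem_central K hmem η)
    _ = ‖ContinuousLinearMap.adjoint (H.tmulRight K η) (H.tmul K ξ η - ζ)‖ := by
        rw [map_sub, H.adjoint_tmulRight_tmul K hη.1]
    _ ≤ 1 * ‖H.tmul K ξ η - ζ‖ := ContinuousLinearMap.le_of_opNorm_le _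
        ((H.norm_adjoint_tmulRight_le K η).trans hη.1.le) _
    _ < α := by rwa [one_mul]

end

end

theorem mainTheorem3 (B D : Type u) [CStarAlgebra B] [CStarAlgebra D] :
    ((HasStrongPropertyT B → HasPropertyT D → HasPropertyT (MaxTensor B D)) ∧
      (HasStrongPropertyT B → HasStrongPropertyT D → HasStrongPropertyT (MaxTensor B D))) ∧
    ((∀ K : HilbertBimodule D, ¬ K.HasAlmostCentralUnitVector) →
      HasStrongPropertyT (MaxTensor B D)) ∧
    ((∃ K : HilbertBimodule D, K.HasAlmostCentralUnitVector) →
      (HasPropertyT (MinTensor B D) → HasPropertyT B) ∧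
      (HasStrongPropertyT (MinTensor B D) → HasStrongPropertyT B)) ∧
    ((HasPropertyT (MinTensor B D) → HasPropertyT B ∨ HasPropertyT D) ∧
      (HasStrongPropertyT (MinTensor B D) → HasStrongPropertyT B ∨ HasStrongPropertyT D)) := by
  refine ⟨⟨fun hB hD => hB.hasPropertyT_completion hD _,
    fun hB hD => hB.hasStrongPropertyT_completion hD _⟩,
    hasStrongPropertyT_of_map (maxCStarSeminorm B D).inr,
    fun ⟨K, hK⟩ => ⟨fun h => h.of_minTensor hK, fun h => h.of_minTensor hK⟩, ?_⟩
  -- If `D` has an almost central unit vector, (c) gives the property for `B`; otherwise `D` has it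
  -- vacuously.
  by_cases hD : ∃ K : HilbertBimodule D, K.HasAlmostCentralUnitVector
  · obtain ⟨K, hK⟩ := hD
    exact ⟨fun h => .inl (h.of_minTensor hK), fun h => .inl (h.of_minTensor hK)⟩
  · rw [not_exists] at hD
    exact ⟨fun _ => .inr (hasPropertyT_of_forall_not hD),
      fun _ => .inr (hasStrongPropertyT_of_forall_not hD)⟩
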